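/- Let $n\ge 1$, $-\infty<a<b<\infty$, and let $A$ be the minimal operator of the differential expression $(-1)^n\frac{d^{2n}}{dx^{2n}}$ in the complex Hilbert space $L^2(a,b)$, i.e. the closure of $\varphi\mapsto(-1)^n\varphi^{(2n)}$ on $C_c^\infty(a,b)$. Then $\operatorname{dom}A^*=W^{2n,2}(a,b)$, $A^*f=(-1)^nf^{(2n)}$, and $(\mathbb C^{2n},\Gamma_0,\Gamma_1)$ with $$\Gamma_0f=\big(f(a),\dots,f^{(n-1)}(a),f(b),\dots,f^{(n-1)}(b)\big)^{\top},$$ $$\Gamma_1f=\big((-1)^{n-1}f^{(2n-1)}(a),\dots,f^{(n)}(a),(-1)^{n}f^{(2n-1)}(b),\dots,-f^{(n)}(b)\big)^{\top}$$ is a boundary triplet for $A^*$: the maps $\Gamma_0,\Gamma_1:\operatorname{dom}A^*\to\mathbb C^{2n}$ are linear, $(A^*f,g)-(f,A^*g)=(\Gamma_1f,\Gamma_0g)-(\Gamma_0f,\Gamma_1g)$ for $f,g\in\operatorname{dom}A^*$, and $f\mapsto(\Gamma_0f,\Gamma_1f)$ maps $\operatorname{dom}A^*$ onto $\mathbb C^{2n}\times\mathbb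 C^{2n}$. (The values $f^{(k)}(a),f^{(k)}(b)$, $k<2n$, are those of the continuous representatives on $[a,b]$.) The Krein (soft) extension $\widehat A_K$ of $A$ is the non-negative self-adjoint extension of $A$ such that $(\widetilde A+x)^{-1}\le(\widehat A_K+x)^{-1}$ for every non-negative self-adjoint extension $\widetilde A$ of $A$ and every $x>0$. It exists, is unique, acts by $\widehat A_Kf=(-1)^nf^{(2n)}$, and has the following domain. (i) $$\operatorname{dom}\widehat A_K=\Big\{f\in W^{2n,2}(a,b):\big(f^{(2n-1)}(b),\dots,f(b)\big)^{\top}=T\big(f^{(2n-1)}(a),\dots,f(a)\big)^{\top}\Big\},$$ where $T$ is the lower-triangular $2n\times2n$ Toeplitz matrix with entries $T_{ij}=\frac{(b-a)^{i-j}}{(i-j)!}$ for $i\ge j$ and $T_{ij}=0$ for $i<j$. (ii) Let $T_1,T_2,Q,S$ be the $n\times n$ matrices with, for $1\le i,j\le n$: $(T_1)_{ij}=\frac{(b-a)^{i-j}}{(i-j)!}$ if $i\ge j$ and $0$ otherwise; $(T_2)_{ij}=\frac{(b-a)^{n+i-j}}{(n+i-j)!}$; $Q=\operatorname{diag}\big((-1)^n,(-1)^{n-1},\dots,-1\big)$;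 $S_{ij}=1$ if $i+j=n+1$ and $0$ otherwise. Then $T_2$ is invertible and $$\operatorname{dom}\widehat A_K=\{f\in W^{2n,2}(a,b):\Gamma_1f=B_K\Gamma_0f\},\qquad B_K=\begin{pmatrix}QT_2^{-1}T_1S&-QT_2^{-1}S\\-QT_1T_2^{-1}T_1S&QT_1T_2^{-1}S\end{pmatrix}.$$ -/

import Mathlib

open MeasureTheory Set
open scoped ContDiff

noncomputable section

namespace KreinExt

/-! ### Non-negative self-adjoint extensions in a Hilbert space -/

section Abstract

variable {H : Type*} [NormedAddCommGroup H] [InnerProductSpace ℂ H] [CompleteSpace H]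

/-- `B` is a non-negative self-adjoint extension of `A`. -/
structure IsNonnegSelfAdjointExtension (A B : H →ₗ.[ℂ] H) : Prop where
  le : A ≤ B
  selfAdjoint : IsSelfAdjoint B
  nonneg : ∀ f : B.domain, 0 ≤ (inner ℂ (f : H) (B f)).re

/-- `R` is the bounded operator `(B + x)⁻¹`, that is, the everywhere defined bounded two-sided
inverse of `B + x : dom B → H`. -/
structure IsResolvent (B : H →ₗ.[ℂ] H) (x : ℝ) (R : H →L[ℂ] H) : Prop where
  right_inv : ∀ g : H, ∃ u : B.domain, (u : H) = R g ∧ B u + (x : ℂ) • (u : H) = g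
  left_inv : ∀ u : B.domain, R (B u + (x : ℂ) • (u : H)) = u

/-- `K` is the Krein (soft) extension of `A`: a non-negative self-adjoint extension such that
`(B + x)⁻¹ ≤ (K + x)⁻¹` for every non-negative self-adjoint extension `B` of `A` and every `x > 0`
(in the order of bounded self-adjoint operators given by the quadratic form). -/
structure IsKreinExtension (A K : H →ₗ.[ℂ] H) : Prop where
  extension : IsNonnegSelfAdjointExtension A K
  resolvent_le : ∀ B : H →ₗ.[ℂ] H, IsNonnegSelfAdjointExtension A B → ∀ x : ℝ, 0 < x →
    ∃ RB RK : H →L[ℂ] H, IsResolvent B x RB ∧ IsResolvent K x RK ∧ RB ≤ RK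

/-- `(G, Γ₀, Γ₁)` is a boundary triplet for the adjoint of `A`: both maps are linear on
`dom A*`, Green's identity holds, and `f ↦ (Γ₀ f, Γ₁ f)` is onto `G × G`.
(The inner product of Mathlib is conjugate linear in its first argument, so that `inner ℂ g f`
is what is usually written `(f, g)`.) -/
structure IsBoundaryTriplet {G : Type*} [NormedAddCommGroup G] [InnerProductSpace ℂ G]
    (A : H →ₗ.[ℂ] H) (Γ₀ Γ₁ : A.adjoint.domain → G) : Prop where
  linear₀ : IsLinearMap ℂ Γ₀
  linear₁ : IsLinearMap ℂ Γ₁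
  green : ∀ f g : A.adjoint.domain,
    inner ℂ (g : H) (A.adjoint f) - inner ℂ (A.adjoint g) (f : H)
      = inner ℂ (Γ₀ g) (Γ₁ f) - inner ℂ (Γ₁ g) (Γ₀ f)
  surjective : Function.Surjective fun f => (Γ₀ f, Γ₁ f)

end Abstract

/-! ### Weak derivatives and Sobolev spaces on an interval -/

/-- The complex Hilbert space `L²(a, b)`. -/
abbrev L2 (a b : ℝ) : Type := Lp ℂ 2 (volume.restrict (Ioo a b))

/-- `φ` is a test function: smooth with compact support inside `(a, b)`. -/
structure IsTest (a b : ℝ) (φ : ℝ → ℂ) : Prop where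
  smooth : ContDiff ℝ ∞ φ
  compact : HasCompactSupport φ
  support : tsupport φ ⊆ Ioo a b

/-- `g` is the weak derivative of order `k` of `f` on `(a, b)`. -/
def HasWeakDeriv {a b : ℝ} (k : ℕ) (f g : L2 a b) : Prop :=
  ∀ φ : ℝ → ℂ, IsTest a b φ →
    ∫ x in Ioo a b, f x * iteratedDeriv k φ x = (-1 : ℂ) ^ k * ∫ x in Ioo a b, g x * φ x

/-- The Sobolev space `W^{m,2}(a, b)`. -/
def sobolev (a b : ℝ) (m : ℕ) : Set (L2 a b) :=
  {f | ∀ k ≤ m, ∃ g : L2 a b, HasWeakDeriv k f g}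

open Classical in
/-- The weak derivative `f^{(k)}` in `L²(a, b)` (and `0` if there is none). -/
def weakDeriv {a b : ℝ} (k : ℕ) (f : L2 a b) : L2 a b :=
  if h : ∃ g : L2 a b, HasWeakDeriv k f g then h.choose else 0

open Classical in
/-- The value at `x ∈ [a, b]` of the representative of `f` that is continuous on `[a, b]`
(and `0` if there is none). -/
def value {a b : ℝ} (f : L2 a b) (x : ℝ) : ℂ :=
  if h : ∃ F : ℝ → ℂ, ContinuousOn F (Icc a b) ∧ f =ᵐ[volume.restrict (Ioo a b)] F then
    h.choose x
  else 0

/-- The value `f^{(k)}(x)` at a point of `[a, b]`; for `f ∈ W^{m,2}(a, b)` and `k < m` the weak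
derivative has a continuous representative on `[a, b]`. -/
def derivValue {a b : ℝ} (f : L2 a b) (k : ℕ) (x : ℝ) : ℂ := value (weakDeriv k f) x

/-! ### The minimal operator -/

lemma IsTest.zero (a b : ℝ) : IsTest a b 0 :=
  ⟨contDiff_const, HasCompactSupport.zero, by simp [tsupport]⟩

lemma IsTest.add {a b : ℝ} {φ ψ : ℝ → ℂ} (hφ : IsTest a b φ) (hψ : IsTest a b ψ) :
    IsTest a b (φ + ψ) :=
  ⟨hφ.smooth.add hψ.smooth, hφ.compact.add hψ.compact,
    (tsupport_add φ ψ).trans (union_subset hφ.support hψ.support)⟩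

lemma IsTest.const_smul {a b : ℝ} {φ : ℝ → ℂ} (c : ℂ) (hφ : IsTest a b φ) :
    IsTest a b (c • φ) := by
  have h : tsupport (c • φ) ⊆ tsupport φ := closure_mono (Function.support_const_smul_subset c φ)
  exact ⟨hφ.smooth.const_smul c, hφ.compact.mono (Function.support_const_smul_subset c φ),
    h.trans hφ.support⟩

/-- The graph of `(-1)ⁿ d²ⁿ/dx²ⁿ` on the test functions. -/
def preminimalGraph (n : ℕ) (a b : ℝ) : Submodule ℂ (L2 a b × L2 a b) where
  carrier := {p | ∃ φ : ℝ → ℂ, IsTest a b φ ∧ p.1 =ᵐ[volume.restrict (Ioo a b)] φ ∧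
    p.2 =ᵐ[volume.restrict (Ioo a b)] fun x => (-1 : ℂ) ^ n * iteratedDeriv (2 * n) φ x}
  zero_mem' := by
    refine ⟨0, IsTest.zero a b, Lp.coeFn_zero _ _ _, ?_⟩
    filter_upwards [Lp.coeFn_zero ℂ 2 (volume.restrict (Ioo a b))] with x hx
    have : iteratedDeriv (2 * n) (0 : ℝ → ℂ) x = 0 := by
      simp [iteratedDeriv_eq_iteratedFDeriv]
    show ((0 : L2 a b) : ℝ → ℂ) x = _
    rw [hx, this]
    simp
  add_mem' := by
    rintro p q ⟨φ, hφ, h1, h2⟩ ⟨ψ, hψ, h3, h4⟩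
    refine ⟨φ + ψ, hφ.add hψ, ?_, ?_⟩
    · filter_upwards [Lp.coeFn_add p.1 q.1, h1, h3] with x hx h1 h3
      show ((p.1 + q.1 : L2 a b) : ℝ → ℂ) x = _
      rw [hx, Pi.add_apply, h1, h3, Pi.add_apply]
    · filter_upwards [Lp.coeFn_add p.2 q.2, h2, h4] with x hx h2 h4
      have hs : ∀ {χ : ℝ → ℂ}, IsTest a b χ → ContDiffAt ℝ (2 * n : ℕ) χ x := fun h =>
        (contDiff_infty.1 h.smooth (2 * n)).contDiffAt
      show ((p.2 + q.2 : L2 a b) : ℝ → ℂ) x = _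
      rw [hx, Pi.add_apply, h2, h4, iteratedDeriv_add (hs hφ) (hs hψ), mul_add]
  smul_mem' := by
    rintro c p ⟨φ, hφ, h1, h2⟩
    refine ⟨c • φ, hφ.const_smul c, ?_, ?_⟩
    · filter_upwards [Lp.coeFn_smul c p.1, h1] with x hx h1
      show ((c • p.1 : L2 a b) : ℝ → ℂ) x = _
      rw [hx, Pi.smul_apply, h1, Pi.smul_apply]
    · filter_upwards [Lp.coeFn_smul c p.2, h2] with x hx h2
      have hs : ContDiffAt ℝ (2 * n : ℕ) φ x :=
        (contDiff_infty.1 hφ.smooth (2 * n)).contDiffAt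
      have := iteratedDeriv_const_smul hs c
      show ((c • p.2 : L2 a b) : ℝ → ℂ) x = _
      rw [hx, Pi.smul_apply, h2, this, smul_eq_mul, smul_eq_mul]
      ring

/-- The graph above is the graph of an operator, so that `Submodule.toLinearPMap` below is this
operator. -/
lemma preminimalGraph_functional (n : ℕ) (a b : ℝ) (p : L2 a b × L2 a b)
    (hp : p ∈ preminimalGraph n a b) (h0 : p.1 = 0) : p.2 = 0 := by
  obtain ⟨φ, hφ, h1, h2⟩ := hp
  have hz : φ =ᵐ[volume.restrict (Ioo a b)] (0 : ℝ → ℂ) := by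
    rw [h0] at h1
    exact h1.symm.trans (Lp.coeFn_zero _ _ _)
  have he : EqOn φ 0 (Ioo a b) :=
    Measure.eqOn_open_of_ae_eq hz isOpen_Ioo hφ.smooth.continuous.continuousOn continuousOn_const
  have hφ0 : φ = 0 := by
    funext x
    by_cases hx : x ∈ Ioo a b
    · exact he hx
    · exact image_eq_zero_of_notMem_tsupport fun h => hx (hφ.support h)
  apply Lp.ext
  filter_upwards [h2, Lp.coeFn_zero ℂ 2 (volume.restrict (Ioo a b))] with x hx hx0
  have : iteratedDeriv (2 * n) (0 : ℝ → ℂ) x = 0 := by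
    simp [iteratedDeriv_eq_iteratedFDeriv]
  rw [hx, hx0, hφ0, this]
  simp

/-- The operator `(-1)ⁿ d²ⁿ/dx²ⁿ` on the test functions, in `L²(a, b)`. -/
def preminimalOp (n : ℕ) (a b : ℝ) : L2 a b →ₗ.[ℂ] L2 a b :=
  (preminimalGraph n a b).toLinearPMap

/-- The minimal operator of `(-1)ⁿ d²ⁿ/dx²ⁿ` in `L²(a, b)`: the closure of the operator on the
test functions. -/
def minimalOp (n : ℕ) (a b : ℝ) : L2 a b →ₗ.[ℂ] L2 a b :=
  (preminimalOp n a b).closure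

/-! ### Boundary maps and matrices -/

/-- The space `ℂ²ⁿ`, its coordinates written as two blocks of length `n`. -/
abbrev BdrySpace (n : ℕ) : Type := EuclideanSpace ℂ (Fin n ⊕ Fin n)

/-- `Γ₀ f = (f(a), …, f^{(n-1)}(a), f(b), …, f^{(n-1)}(b))`. -/
def Gamma0 (n : ℕ) {a b : ℝ} (f : L2 a b) : BdrySpace n :=
  WithLp.toLp 2 (Sum.elim (fun i : Fin n => derivValue f i a) (fun i : Fin n => derivValue f i b))

/-- `Γ₁ f = ((-1)^{n-1} f^{(2n-1)}(a), …, f^{(n)}(a), (-1)^n f^{(2n-1)}(b), …, -f^{(n)}(b))`. -/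
def Gamma1 (n : ℕ) {a b : ℝ} (f : L2 a b) : BdrySpace n :=
  WithLp.toLp 2 (Sum.elim
    (fun i : Fin n => (-1 : ℂ) ^ (n - 1 - (i : ℕ)) * derivValue f (2 * n - 1 - i) a)
    (fun i : Fin n => (-1 : ℂ) ^ (n - (i : ℕ)) * derivValue f (2 * n - 1 - i) b))

/-- The vector `(f^{(m-1)}(x), …, f'(x), f(x))`. -/
def descJet (m : ℕ) {a b : ℝ} (f : L2 a b) (x : ℝ) : Fin m → ℂ :=
  fun i => derivValue f (m - 1 - i) x

/-- The lower triangular Toeplitz matrix of size `m` with entries `ℓ^{i-j} / (i-j)!`, `j ≤ i`. -/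
def matT (m : ℕ) (ℓ : ℝ) : Matrix (Fin m) (Fin m) ℂ :=
  Matrix.of fun i j =>
    if j ≤ i then (ℓ : ℂ) ^ ((i : ℕ) - (j : ℕ)) / (((i : ℕ) - (j : ℕ)).factorial : ℂ) else 0

/-- The Toeplitz matrix of size `n` with entries `ℓ^{n+i-j} / (n+i-j)!`. -/
def matT2 (n : ℕ) (ℓ : ℝ) : Matrix (Fin n) (Fin n) ℂ :=
  Matrix.of fun i j =>
    (ℓ : ℂ) ^ (n + (i : ℕ) - (j : ℕ)) / ((n + (i : ℕ) - (j : ℕ)).factorial : ℂ)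

/-- `Q = diag((-1)^n, (-1)^{n-1}, …, -1)`. -/
def matQ (n : ℕ) : Matrix (Fin n) (Fin n) ℂ :=
  Matrix.diagonal fun i => (-1 : ℂ) ^ (n - (i : ℕ))

/-- `S` is the antidiagonal unit matrix. -/
def matS (n : ℕ) : Matrix (Fin n) (Fin n) ℂ :=
  Matrix.of fun i j => if (i : ℕ) + (j : ℕ) + 1 = n then 1 else 0

/-- The block matrix `B_K`. -/
def matBK (n : ℕ) (ℓ : ℝ) : Matrix (Fin n ⊕ Fin n) (Fin n ⊕ Fin n) ℂ :=
  Matrix.fromBlocks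
    (matQ n * (matT2 n ℓ)⁻¹ * matT n ℓ * matS n)
    (-(matQ n * (matT2 n ℓ)⁻¹ * matS n))
    (-(matQ n * matT n ℓ * (matT2 n ℓ)⁻¹ * matT n ℓ * matS n))
    (matQ n * matT n ℓ * (matT2 n ℓ)⁻¹ * matS n)

end KreinExt

end

/-!
Write `A` for the minimal operator. Testing against the test functions shows that `A*` is the
maximal operator: `A* f = g` says that `(-1)ⁿ g` is the weak derivative of `f` of order `2n`. By the
lemma of du Bois-Reymond (`exists_polynomial_ae_eq`) such an `f` differs by a polynomial from a
`2n`-fold primitive of `(-1)ⁿ g`, so that `dom A* = W^{2n,2}(a, b)`, and its derivatives of order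
less than `2n` have continuous representatives on `[a, b]`. They are handled as chains of
successive indefinite integrals (`IsJet`, `IsJetOf`). Integrating by parts `n` times gives the first
Green identity `⟨g, A* f⟩ = ⟨Γ₀ g, Γ₁ f⟩ + ⟨g⁽ⁿ⁾, f⁽ⁿ⁾⟩` (`inner_adjoint_minimalOp`), from which
Green's identity follows by antisymmetrization; smooth cutoffs show that the boundary values are
arbitrary.

The Krein extension is the restriction `K` of `A*` to those `f` for which `A* f` is orthogonal to
`ker A*`, the polynomials of degree less than `2n` (`softExtension`). Repeated integration by parts
shows that these are the `f` whose derivatives at `b` are those of the Taylor polynomial `p` of `f`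
at `a` (`IsJetOf.mem_softDomain_iff`), so that `f = w + p` where all boundary values of `w` vanish.
By Green's identity `A* w` is then orthogonal to `ker A*`, `⟨f, K f⟩ = ⟨w, A* w⟩ = ‖w⁽ⁿ⁾‖² ≥ 0`, and
every self-adjoint extension `B` of `A` contains `w`. If `(B + x) u = h = (K + x) v` with
`v = w + p`, then `⟨h, u⟩ = ⟨w, B u⟩ + x ⟨v, u⟩`, and expanding `0 ≤ ⟨w - u, B (w - u)⟩` and
`0 ≤ x ‖v - u‖²` yields `⟨h, u⟩ ≤ ⟨h, v⟩` (`re_inner_le_of_decomposition`), which is the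
comparison of the resolvents. Uniqueness is antisymmetry of the order.

Taylor's formula for polynomials of degree less than `2n` turns the condition on `f` into the matrix
condition with `T`. Its lower block is solved for the derivatives of order at least `n` at `a` by
inverting `T₂`, which gives `B_K`. The matrix `T₂` is injective because a polynomial of degree less
than `2n` that vanishes to the order `n` at both end points is zero, by the first Green identity.
-/

namespace KreinExt

/-! ### Resolvents and the Krein extension in a Hilbert space -/

section Abstract

variable {H : Type*} [NormedAddCommGroup H] [InnerProductSpace ℂ H] [CompleteSpace H]

lemma inner_apply_eq_of_isSelfAdjoint {B : H →ₗ.[ℂ] H} (hB : IsSelfAdjoint B) (u v : B.domain) :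
    inner ℂ (B u) (v : H) = inner ℂ (u : H) (B v) := by
  have h := LinearPMap.adjoint_isFormalAdjoint hB.dense_domain
  rw [LinearPMap.isSelfAdjoint_def.1 hB] at h
  exact h u v

lemma exists_mem_domain_of_isSelfAdjoint {B : H →ₗ.[ℂ] H} (hB : IsSelfAdjoint B) {y w : H}
    (h : ∀ u : B.domain, inner ℂ w (u : H) = inner ℂ y (B u)) :
    ∃ hy : y ∈ B.domain, B ⟨y, hy⟩ = w := by
  have hA := LinearPMap.isSelfAdjoint_def.1 hB
  have key : ∃ hy : y ∈ B.adjoint.domain, B.adjoint ⟨y, hy⟩ = w :=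
    ⟨LinearPMap.mem_adjoint_domain_of_exists y ⟨w, h⟩,
      LinearPMap.adjoint_apply_eq hB.dense_domain _ h⟩
  rwa [hA] at key

omit [CompleteSpace H] in
lemma norm_le_of_nonneg {B : H →ₗ.[ℂ] H}
    (hn : ∀ f : B.domain, 0 ≤ (inner ℂ (f : H) (B f)).re) (x : ℝ) (u : B.domain) :
    x * ‖(u : H)‖ ≤ ‖B u + (x : ℂ) • (u : H)‖ := by
  have h1 : (inner ℂ (u : H) (B u + (x : ℂ) • (u : H))).re
      = (inner ℂ (u : H) (B u)).re + x * ‖(u : H)‖ ^ 2 := by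
    rw [inner_add_right, inner_smul_right, inner_self_eq_norm_sq_to_K, Complex.add_re]
    congr 1
    rw [← RCLike.ofReal_pow]
    exact Complex.re_ofReal_mul _ _
  have h2 : (inner ℂ (u : H) (B u + (x : ℂ) • (u : H))).re
      ≤ ‖(u : H)‖ * ‖B u + (x : ℂ) • (u : H)‖ :=
    (Complex.re_le_norm _).trans (norm_inner_le_norm _ _)
  have h3 := hn u
  rcases (norm_nonneg (u : H)).eq_or_lt with h0 | h0
  · rw [← h0, mul_zero]; exact norm_nonneg _
  · refine le_of_mul_le_mul_left ?_ h0
    nlinarith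

/-- The range of `B + x` is closed because `B` is closed and `B + x` is bounded below; it is dense
because a vector orthogonal to it would be an eigenvector of `B` for the eigenvalue `-x`. -/
lemma exists_apply_add_smul_eq {B : H →ₗ.[ℂ] H} (hB : IsSelfAdjoint B)
    (hn : ∀ f : B.domain, 0 ≤ (inner ℂ (f : H) (B f)).re) {x : ℝ} (hx : 0 < x) (g : H) :
    ∃ u : B.domain, B u + (x : ℂ) • (u : H) = g := by
  -- The map `(u, B u) ↦ B u + x u` on the graph, a complete space, is bounded below.
  set L : B.graph →L[ℂ] H :=
    ((ContinuousLinearMap.snd ℂ H H) + (x : ℂ) • (ContinuousLinearMap.fst ℂ H H)).comp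
      B.graph.subtypeL with hL
  have hLapp : ∀ p : B.graph, L p = (p : H × H).2 + (x : ℂ) • (p : H × H).1 := fun p => rfl
  have hgraph : ∀ p : B.graph, ∃ u : B.domain, (p : H × H) = ((u : H), B u) := by
    intro p
    obtain ⟨u, hu1, hu2⟩ := (LinearPMap.mem_graph_iff B).1 p.2
    exact ⟨u, Prod.ext hu1.symm hu2.symm⟩
  have hclosed : IsClosed (B.graph : Set (H × H)) := hB.isClosed
  have : CompleteSpace B.graph := hclosed.completeSpace_coe
  have hbound : ∀ p : B.graph, ‖p‖ ≤ ((2 + 1 / x).toNNReal : ℝ) * ‖L p‖ := by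
    intro p
    obtain ⟨u, hu⟩ := hgraph p
    rw [Real.coe_toNNReal _ (by positivity), hLapp, hu]
    have h1 := norm_le_of_nonneg hn x u
    set y := B u + (x : ℂ) • (u : H) with hy
    have h2 : ‖(u : H)‖ ≤ 1 / x * ‖y‖ := by
      rw [div_mul_eq_mul_div, one_mul, le_div_iff₀ hx]; linarith
    have h3 : ‖B u‖ ≤ 2 * ‖y‖ := by
      have : B u = y - (x : ℂ) • (u : H) := by rw [hy]; abel
      have h4 : ‖(x : ℂ) • (u : H)‖ = x * ‖(u : H)‖ := by
        rw [norm_smul, Complex.norm_real, Real.norm_of_nonneg hx.le]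
      calc ‖B u‖ ≤ ‖y‖ + ‖(x : ℂ) • (u : H)‖ := by rw [this]; exact norm_sub_le _ _
        _ ≤ 2 * ‖y‖ := by rw [h4]; linarith
    have h5 : ‖p‖ = max ‖(u : H)‖ ‖B u‖ := by
      change ‖(p : H × H)‖ = _
      rw [hu]; rfl
    have h6 : 0 ≤ 1 / x * ‖y‖ := by positivity
    rw [h5]
    refine max_le ?_ ?_ <;> nlinarith [norm_nonneg y]
  have hanti : AntilipschitzWith (2 + 1 / x).toNNReal L :=
    AddMonoidHomClass.antilipschitz_of_bound L hbound
  have hrange : IsClosed (range L) := hanti.isClosed_range L.uniformContinuous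
  have htop : LinearMap.range (L : B.graph →ₗ[ℂ] H) = ⊤ := by
    have : CompleteSpace (LinearMap.range (L : B.graph →ₗ[ℂ] H)) :=
      (show IsClosed (LinearMap.range (L : B.graph →ₗ[ℂ] H) : Set H) from hrange).completeSpace_coe
    rw [← Submodule.orthogonal_eq_bot_iff, Submodule.eq_bot_iff]
    intro y hy
    have hy' : ∀ u : B.domain, inner ℂ (-(x : ℂ) • y) (u : H) = inner ℂ y (B u) := by
      intro u
      have h1 := (Submodule.mem_orthogonal' _ _).1 hy (B u + (x : ℂ) • (u : H))
        ⟨⟨((u : H), B u), LinearPMap.mem_graph B u⟩, rfl⟩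
      rw [inner_add_right, inner_smul_right] at h1
      rw [inner_smul_left, map_neg, Complex.conj_ofReal]
      linear_combination -h1
    obtain ⟨hyd, hyB⟩ := exists_mem_domain_of_isSelfAdjoint hB hy'
    have h2 := norm_le_of_nonneg hn x ⟨y, hyd⟩
    rw [hyB] at h2
    simp only [neg_smul, neg_add_cancel, norm_zero] at h2
    have : ‖y‖ ≤ 0 := by
      by_contra hc
      push Not at hc
      nlinarith
    exact norm_le_zero_iff.1 this
  obtain ⟨p, hp⟩ : g ∈ LinearMap.range (L : B.graph →ₗ[ℂ] H) := htop ▸ Submodule.mem_top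
  obtain ⟨u, hu⟩ := hgraph p
  refine ⟨u, ?_⟩
  rw [← hp]
  change _ = L p
  rw [hLapp, hu]

/-- The resolvent `(B + x)⁻¹`, `x > 0`, of a non-negative self-adjoint operator exists. -/
lemma exists_isResolvent {B : H →ₗ.[ℂ] H} (hB : IsSelfAdjoint B)
    (hn : ∀ f : B.domain, 0 ≤ (inner ℂ (f : H) (B f)).re) {x : ℝ} (hx : 0 < x) :
    ∃ R : H →L[ℂ] H, IsResolvent B x R := by
  set M : B.domain →ₗ[ℂ] H := B.toFun + (x : ℂ) • B.domain.subtype with hM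
  have hMapp : ∀ u : B.domain, M u = B u + (x : ℂ) • (u : H) := fun u => rfl
  have hinj : Function.Injective M := by
    rw [← LinearMap.ker_eq_bot, LinearMap.ker_eq_bot']
    intro u hu
    have h := norm_le_of_nonneg hn x u
    rw [← hMapp, hu, norm_zero] at h
    have : ‖(u : H)‖ ≤ 0 := by
      by_contra hc
      push Not at hc
      nlinarith
    exact Subtype.ext (norm_le_zero_iff.1 this)
  have hsurj : Function.Surjective M := fun g => exists_apply_add_smul_eq hB hn hx g
  set e := LinearEquiv.ofBijective M ⟨hinj, hsurj⟩ with he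
  have hbound : ∀ g : H, ‖(B.domain.subtype ∘ₗ (e.symm : H →ₗ[ℂ] B.domain)) g‖ ≤ 1 / x * ‖g‖ := by
    intro g
    have h := norm_le_of_nonneg hn x (e.symm g)
    have h2 : M (e.symm g) = g := e.apply_symm_apply g
    rw [← hMapp, h2] at h
    rw [div_mul_eq_mul_div, one_mul, le_div_iff₀ hx, mul_comm]
    exact h
  refine ⟨LinearMap.mkContinuous _ (1 / x) hbound, fun g => ⟨e.symm g, rfl, ?_⟩, fun u => ?_⟩
  · exact e.apply_symm_apply g
  · have : e.symm (M u) = u := e.symm_apply_apply u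
    change ((e.symm (M u) : B.domain) : H) = u
    rw [this]

omit [CompleteSpace H] in
lemma IsResolvent.unique {B : H →ₗ.[ℂ] H} {x : ℝ} {R R' : H →L[ℂ] H} (h : IsResolvent B x R)
    (h' : IsResolvent B x R') : R = R' := by
  ext g
  obtain ⟨u, hu, hg⟩ := h.right_inv g
  rw [← hu, ← h'.left_inv u, hg]

omit [CompleteSpace H] in
lemma le_of_isResolvent {B C : H →ₗ.[ℂ] H} {x : ℝ} {R : H →L[ℂ] H} (hB : IsResolvent B x R)
    (hC : IsResolvent C x R) : B ≤ C := by
  have key : ∀ u : B.domain, ∃ v : C.domain, (v : H) = u ∧ C v = B u := by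
    intro u
    obtain ⟨v, hv, hvC⟩ := hC.right_inv (B u + (x : ℂ) • (u : H))
    rw [hB.left_inv u] at hv
    exact ⟨v, hv, by rw [hv] at hvC; exact add_right_cancel hvC⟩
  refine ⟨fun y hy => ?_, fun u v huv => ?_⟩
  · obtain ⟨v, hv, -⟩ := key ⟨y, hy⟩
    have hv' : (v : H) = y := hv
    exact hv' ▸ v.2
  · obtain ⟨w, hw, hwC⟩ := key u
    have : w = v := Subtype.ext (hw.trans huv)
    rw [← hwC, this]

/-- Two Krein extensions have the same resolvents by antisymmetry, hence are equal. -/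
lemma IsKreinExtension.unique {A K K' : H →ₗ.[ℂ] H} (h : IsKreinExtension A K)
    (h' : IsKreinExtension A K') : K = K' := by
  obtain ⟨R, R', hR, hR', hle⟩ := h'.resolvent_le K h.extension 1 one_pos
  obtain ⟨S', S, hS', hS, hle'⟩ := h.resolvent_le K' h'.extension 1 one_pos
  rw [hS'.unique hR', hS.unique hR] at hle'
  obtain rfl := le_antisymm hle hle'
  exact le_antisymm (le_of_isResolvent hR hR') (le_of_isResolvent hR' hR)

/-- The subspace of the `f ∈ dom A*` with `A* f` orthogonal to `ker A*`. -/
def softDomain (A : H →ₗ.[ℂ] H) : Submodule ℂ H where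
  carrier := {f | ∃ hf : f ∈ A.adjoint.domain, ∀ p : A.adjoint.domain, A.adjoint p = 0 →
    inner ℂ (p : H) (A.adjoint ⟨f, hf⟩) = 0}
  zero_mem' := ⟨zero_mem _, fun p _ => by
    have : A.adjoint ⟨0, zero_mem _⟩ = 0 := A.adjoint.map_zero
    rw [this, inner_zero_right]⟩
  add_mem' := by
    rintro f g ⟨hf, h1⟩ ⟨hg, h2⟩
    refine ⟨add_mem hf hg, fun p hp => ?_⟩
    have : A.adjoint ⟨f + g, add_mem hf hg⟩ = A.adjoint ⟨f, hf⟩ + A.adjoint ⟨g, hg⟩ :=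
      A.adjoint.map_add ⟨f, hf⟩ ⟨g, hg⟩
    rw [this, inner_add_right, h1 p hp, h2 p hp, add_zero]
  smul_mem' := by
    rintro c f ⟨hf, h1⟩
    refine ⟨Submodule.smul_mem _ c hf, fun p hp => ?_⟩
    have : A.adjoint ⟨c • f, Submodule.smul_mem _ c hf⟩ = c • A.adjoint ⟨f, hf⟩ :=
      A.adjoint.map_smul c ⟨f, hf⟩
    rw [this, inner_smul_right, h1 p hp, mul_zero]

/-- The restriction of `A*` to `softDomain A`. -/
noncomputable def softExtension (A : H →ₗ.[ℂ] H) : H →ₗ.[ℂ] H where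
  domain := softDomain A
  toFun := A.adjoint.toFun ∘ₗ
    Submodule.inclusion (fun _ hf => hf.1 : softDomain A ≤ A.adjoint.domain)

lemma softExtension_apply (A : H →ₗ.[ℂ] H) (f : (softExtension A).domain) :
    softExtension A f = A.adjoint ⟨f, f.2.1⟩ := rfl

/-- The vectors `w ∈ dom A*` on which the boundary form of `A*` vanishes. -/
def IsMinimalVector (A : H →ₗ.[ℂ] H) (w : A.adjoint.domain) : Prop :=
  ∀ g : A.adjoint.domain, inner ℂ (g : H) (A.adjoint w) = inner ℂ (A.adjoint g) (w : H)

section Decomposition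

variable {A : H →ₗ.[ℂ] H} (hA : Dense (A.domain : Set H)) (hsymm : A ≤ A.adjoint)
  (hnonneg : ∀ w : A.adjoint.domain, IsMinimalVector A w →
    0 ≤ (inner ℂ (w : H) (A.adjoint w)).re)
  (hdec : ∀ f : (softExtension A).domain, ∃ w p : A.adjoint.domain, IsMinimalVector A w ∧
    A.adjoint p = 0 ∧ (f : H) = w + p)

include hdec in
lemma exists_softExtension_decomposition (f : (softExtension A).domain) :
    ∃ w p : A.adjoint.domain, IsMinimalVector A w ∧ A.adjoint p = 0 ∧ (f : H) = w + p ∧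
      softExtension A f = A.adjoint w := by
  obtain ⟨w, p, hw, hp, hf⟩ := hdec f
  refine ⟨w, p, hw, hp, hf, ?_⟩
  have : (⟨f, f.2.1⟩ : A.adjoint.domain) = w + p := Subtype.ext hf
  rw [softExtension_apply, this, A.adjoint.map_add, hp, add_zero]

include hsymm hA in
lemma le_softExtension : A ≤ softExtension A := by
  have hmem : ∀ y (hy : y ∈ A.domain), A.adjoint ⟨y, hsymm.1 hy⟩ = A ⟨y, hy⟩ := fun y hy =>
    (hsymm.2 (x := ⟨y, hy⟩) (y := ⟨y, hsymm.1 hy⟩) rfl).symm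
  refine ⟨fun y hy => ⟨hsymm.1 hy, fun p hp => ?_⟩, fun u v huv => ?_⟩
  · rw [hmem y hy, ← LinearPMap.adjoint_isFormalAdjoint hA p ⟨y, hy⟩, hp, inner_zero_left]
  · rw [softExtension_apply, ← hmem u u.2]
    congr 1
    exact Subtype.ext huv

include hdec in
lemma softExtension_isFormalAdjoint : (softExtension A).IsFormalAdjoint (softExtension A) := by
  intro f g
  obtain ⟨w, p, hw, hp, hf, hfA⟩ := exists_softExtension_decomposition hdec f
  obtain ⟨v, q, hv, hq, hg, hgA⟩ := exists_softExtension_decomposition hdec g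
  have h1 : inner ℂ (A.adjoint w) (q : H) = 0 := by
    rw [← inner_conj_symm, hw q, hq, inner_zero_left, map_zero]
  have h2 : inner ℂ (p : H) (A.adjoint v) = 0 := by rw [hv p, hp, inner_zero_left]
  rw [hfA, hgA, hf, hg, inner_add_right, inner_add_left, h1, h2, hv w]

include hA hsymm hdec in
lemma isSelfAdjoint_softExtension : IsSelfAdjoint (softExtension A) := by
  have hle := le_softExtension hA hsymm
  have hd : Dense ((softExtension A).domain : Set H) := hA.mono hle.1
  rw [LinearPMap.isSelfAdjoint_def]
  refine le_antisymm ?_ ((softExtension_isFormalAdjoint hdec).le_adjoint hd)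
  have hform := LinearPMap.adjoint_isFormalAdjoint hd
  have key : ∀ f : (softExtension A).adjoint.domain, ∃ hf : (f : H) ∈ A.adjoint.domain,
      A.adjoint ⟨f, hf⟩ = (softExtension A).adjoint f := by
    intro f
    have h : ∀ u : A.domain, inner ℂ ((softExtension A).adjoint f) (u : H)
        = inner ℂ (f : H) (A u) := by
      intro u
      have h3 : A u = softExtension A ⟨u, hle.1 u.2⟩ := hle.2 rfl
      rw [h3]
      exact hform f ⟨u, hle.1 u.2⟩
    exact ⟨LinearPMap.mem_adjoint_domain_of_exists _ ⟨_, h⟩, LinearPMap.adjoint_apply_eq hA _ h⟩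
  -- Testing with `ker A*`, which the soft extension maps to zero, gives the orthogonality.
  have hker : ∀ p : A.adjoint.domain, A.adjoint p = 0 → (p : H) ∈ softDomain A :=
    fun p hp => ⟨p.2, fun q _ => by
      rw [show (⟨(p : H), p.2⟩ : A.adjoint.domain) = p from rfl, hp, inner_zero_right]⟩
  refine ⟨fun y hy => ?_, fun u v huv => ?_⟩
  · obtain ⟨hf, hfA⟩ := key ⟨y, hy⟩
    refine ⟨hf, fun p hp => ?_⟩
    have h4 := hform ⟨y, hy⟩ ⟨p, hker p hp⟩
    have h5 : softExtension A ⟨p, hker p hp⟩ = 0 := by rw [softExtension_apply]; exact hp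
    rw [h5, inner_zero_right, ← hfA] at h4
    rw [← inner_conj_symm, h4, map_zero]
  · obtain ⟨hf, hfA⟩ := key u
    rw [← hfA, softExtension_apply]
    congr 1
    exact Subtype.ext huv

include hA hsymm hnonneg hdec in
lemma softExtension_isNonnegSelfAdjointExtension :
    IsNonnegSelfAdjointExtension A (softExtension A) := by
  refine ⟨le_softExtension hA hsymm, isSelfAdjoint_softExtension hA hsymm hdec, fun f => ?_⟩
  obtain ⟨w, p, hw, hp, hf, hfA⟩ := exists_softExtension_decomposition hdec f
  rw [hfA, hf, inner_add_left, hw p, hp, inner_zero_left, add_zero]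
  exact hnonneg w hw

include hA in
/-- A self-adjoint extension of `A` contains the minimal vectors. -/
lemma IsNonnegSelfAdjointExtension.exists_mem_domain {B : H →ₗ.[ℂ] H}
    (hB : IsNonnegSelfAdjointExtension A B) {w : A.adjoint.domain} (hw : IsMinimalVector A w) :
    ∃ h : (w : H) ∈ B.domain, B ⟨w, h⟩ = A.adjoint w := by
  apply exists_mem_domain_of_isSelfAdjoint hB.selfAdjoint
  intro u
  have h : ∀ v : A.domain, inner ℂ (B u) (v : H) = inner ℂ (u : H) (A v) := by
    intro v
    have h3 : A v = B ⟨v, hB.le.1 v.2⟩ := hB.le.2 rfl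
    rw [h3]
    exact inner_apply_eq_of_isSelfAdjoint hB.selfAdjoint u ⟨v, hB.le.1 v.2⟩
  have hu : (u : H) ∈ A.adjoint.domain :=
    LinearPMap.mem_adjoint_domain_of_exists _ ⟨_, h⟩
  have huA : A.adjoint ⟨u, hu⟩ = B u := LinearPMap.adjoint_apply_eq hA _ h
  rw [← huA, ← inner_conj_symm, hw ⟨u, hu⟩, inner_conj_symm]

include hA in
/-- For `h = (B + x) u = (K + x) v` and `v = w + p` with `w` minimal and `p ∈ ker A*` one has
`⟨h, u⟩ = ⟨w, B u⟩ + x ⟨v, u⟩`. Expanding `0 ≤ ⟨w - u, B (w - u)⟩` and `0 ≤ x ‖v - u‖²` bounds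
twice the right-hand side by `⟨h, v⟩ + ⟨h, u⟩`, so that `⟨h, u⟩ ≤ ⟨h, v⟩`. -/
lemma re_inner_le_of_decomposition {B : H →ₗ.[ℂ] H} (hB : IsNonnegSelfAdjointExtension A B)
    {w p : A.adjoint.domain} (hw : IsMinimalVector A w) (hp : A.adjoint p = 0)
    {x : ℝ} (hx : 0 < x) {h v : H} (u : B.domain) (hv : v = w + p)
    (hu : B u + (x : ℂ) • (u : H) = h) (hvh : A.adjoint w + (x : ℂ) • v = h) :
    (inner ℂ (u : H) h).re ≤ (inner ℂ v h).re := by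
  obtain ⟨hwB, hBw⟩ := hB.exists_mem_domain hA hw
  have e1 : (inner ℂ (u : H) h).re
      = (inner ℂ (u : H) (A.adjoint w)).re + x * (inner ℂ (u : H) v).re := by
    rw [← hvh, inner_add_right, inner_smul_right, Complex.add_re, Complex.re_ofReal_mul]
  have e2 : (inner ℂ (u : H) h).re
      = (inner ℂ (u : H) (B u)).re + x * (inner ℂ (u : H) (u : H)).re := by
    rw [← hu, inner_add_right, inner_smul_right, Complex.add_re, Complex.re_ofReal_mul]
  have e3 : (inner ℂ v h).re
      = (inner ℂ (w : H) (A.adjoint w)).re + x * (inner ℂ v v).re := by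
    rw [← hvh, inner_add_right, inner_smul_right, Complex.add_re, Complex.re_ofReal_mul]
    congr 2
    rw [hv, inner_add_left, hw p, hp, inner_zero_left, add_zero]
  have e4 := hB.nonneg (⟨w, hwB⟩ - u)
  have e5 : B (⟨w, hwB⟩ - u) = A.adjoint w - B u := by rw [B.map_sub, hBw]
  have e6 : (inner ℂ (w : H) (B u)).re = (inner ℂ (u : H) (A.adjoint w)).re := by
    have := inner_apply_eq_of_isSelfAdjoint hB.selfAdjoint ⟨w, hwB⟩ u
    rw [← this, hBw, ← inner_conj_symm, Complex.conj_re]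
  rw [e5] at e4
  have e7 : (((⟨w, hwB⟩ - u : B.domain)) : H) = w - u := rfl
  rw [e7, inner_sub_left, inner_sub_right, inner_sub_right, Complex.sub_re, Complex.sub_re,
    Complex.sub_re, e6] at e4
  have e8 : 0 ≤ (inner ℂ (v - (u : H)) (v - (u : H))).re := inner_self_nonneg (𝕜 := ℂ)
  have e9 : (inner ℂ v (u : H)).re = (inner ℂ (u : H) v).re := by
    rw [← inner_conj_symm, Complex.conj_re]
  rw [inner_sub_left, inner_sub_right, inner_sub_right, Complex.sub_re, Complex.sub_re,
    Complex.sub_re, e9] at e8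
  nlinarith [mul_nonneg hx.le e8]

lemma IsResolvent.isSymmetric {B : H →ₗ.[ℂ] H} (hB : IsSelfAdjoint B) {x : ℝ} {R : H →L[ℂ] H}
    (hR : IsResolvent B x R) : (R : H →ₗ[ℂ] H).IsSymmetric := by
  intro g h
  obtain ⟨u, hu, hg⟩ := hR.right_inv g
  obtain ⟨v, hv, hh⟩ := hR.right_inv h
  change inner ℂ (R g) h = inner ℂ g (R h)
  rw [← hu, ← hv, ← hg, ← hh, inner_add_left, inner_add_right, inner_smul_left, inner_smul_right,
    Complex.conj_ofReal, inner_apply_eq_of_isSelfAdjoint hB u v]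

include hA hsymm hnonneg hdec in
/-- If every vector of `softDomain A` is the sum of a minimal vector and of a vector of `ker A*`,
and if `A*` is non-negative on the minimal vectors, then the restriction of `A*` to `softDomain A`
is the Krein extension. -/
theorem isKreinExtension_softExtension : IsKreinExtension A (softExtension A) := by
  have hK := softExtension_isNonnegSelfAdjointExtension hA hsymm hnonneg hdec
  refine ⟨hK, fun B hB x hx => ?_⟩
  obtain ⟨RB, hRB⟩ := exists_isResolvent hB.selfAdjoint hB.nonneg hx
  obtain ⟨RK, hRK⟩ := exists_isResolvent hK.selfAdjoint hK.nonneg hx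
  refine ⟨RB, RK, hRB, hRK, ?_⟩
  rw [ContinuousLinearMap.le_def, ContinuousLinearMap.isPositive_def]
  refine ⟨?_, fun h => ?_⟩
  · exact (hRK.isSymmetric hK.selfAdjoint).sub (hRB.isSymmetric hB.selfAdjoint)
  · obtain ⟨u, hu, huh⟩ := hRB.right_inv h
    obtain ⟨v, hv, hvh⟩ := hRK.right_inv h
    obtain ⟨w, p, hw, hp, hvwp, hvA⟩ := exists_softExtension_decomposition hdec v
    have := re_inner_le_of_decomposition hA hB hw hp hx u hvwp huh (by rw [← hvA]; exact hvh)
    rw [ContinuousLinearMap.reApplyInnerSelf_apply]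
    change 0 ≤ (inner ℂ (RK h - RB h) h).re
    rw [inner_sub_left, ← hu, ← hv, Complex.sub_re]
    linarith

end Decomposition

end Abstract

/-! ### Integration by parts for indefinite integrals -/

lemma absolutelyContinuousOnInterval_integral {f : ℝ → ℂ} {a b : ℝ}
    (hf : IntervalIntegrable f volume a b) :
    AbsolutelyContinuousOnInterval (fun x => ∫ t in a..x, f t) a b := by
  have hre : IntervalIntegrable (fun t => (f t).re) volume a b :=
    ⟨hf.1.re, hf.2.re⟩
  have him : IntervalIntegrable (fun t => (f t).im) volume a b :=
    ⟨hf.1.im, hf.2.im⟩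
  have hc : ∀ z : ℂ, AbsolutelyContinuousOnInterval (fun _ : ℝ => z) a b := fun z =>
    ContDiffOn.absolutelyContinuousOnInterval contDiffOn_const
  have h1 := (hre.absolutelyContinuousOnInterval_intervalIntegral (c := a) left_mem_uIcc).smul
    (hc 1)
  have h2 := (him.absolutelyContinuousOnInterval_intervalIntegral (c := a) left_mem_uIcc).smul
    (hc Complex.I)
  -- Absolute continuity of primitives is available for real functions: treat real and imaginary
  -- parts separately.
  have h3 := h1.add h2
  rw [absolutelyContinuousOnInterval_iff] at h3 ⊢
  have heq : ∀ x ∈ uIcc a b, (∫ t in a..x, f t)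
      = ((fun x ↦ ∫ v in a..x, (f v).re) • (fun _ : ℝ => (1 : ℂ))
        + (fun x ↦ ∫ v in a..x, (f v).im) • (fun _ : ℝ => Complex.I)) x := by
    intro x hx
    have hfx : IntervalIntegrable f volume a x := hf.mono_set (uIcc_subset_uIcc_left hx)
    simp only [Pi.add_apply, Pi.smul_apply', Complex.real_smul, mul_one]
    apply Complex.ext
    · simpa using (intervalIntegral.intervalIntegral_re (𝕜 := ℂ) hfx).symm
    · simpa using (intervalIntegral.intervalIntegral_im (𝕜 := ℂ) hfx).symm
  intro ε hε
  obtain ⟨δ, hδ, h⟩ := h3 ε hε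
  refine ⟨δ, hδ, fun E hE hlt => ?_⟩
  have := h E hE hlt
  convert this using 2 with i hi
  have hI := hE.1 i hi
  rw [heq _ hI.1, heq _ hI.2]

/-- Integration by parts for the indefinite integrals `u`, `v` of integrable functions `f`, `g`. -/
lemma integral_mul_add_mul_eq_sub {f g u v : ℝ → ℂ} {a b : ℝ} (hab : a ≤ b)
    (hf : IntervalIntegrable f volume a b) (hg : IntervalIntegrable g volume a b)
    (hu : ∀ x ∈ Icc a b, u x - u a = ∫ t in a..x, f t)
    (hv : ∀ x ∈ Icc a b, v x - v a = ∫ t in a..x, g t) :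
    ∫ x in a..b, (f x * v x + u x * g x) = u b * v b - u a * v a := by
  set U : ℝ → ℂ := fun x => u a + ∫ t in a..x, f t with hU
  set V : ℝ → ℂ := fun x => v a + ∫ t in a..x, g t with hV
  have huU : ∀ x ∈ Icc a b, u x = U x := fun x hx => by rw [hU]; simp only [← hu x hx]; ring
  have hvV : ∀ x ∈ Icc a b, v x = V x := fun x hx => by rw [hV]; simp only [← hv x hx]; ring
  have hc : ∀ z : ℂ, AbsolutelyContinuousOnInterval (fun _ : ℝ => z) a b := fun z =>
    ContDiffOn.absolutelyContinuousOnInterval contDiffOn_const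
  have hUac : AbsolutelyContinuousOnInterval U a b :=
    (hc (u a)).add (absolutelyContinuousOnInterval_integral hf)
  have hVac : AbsolutelyContinuousOnInterval V a b :=
    (hc (v a)).add (absolutelyContinuousOnInterval_integral hg)
  have hint : IntervalIntegrable (fun x => f x * V x + U x * g x) volume a b :=
    (hf.mul_continuousOn hVac.continuousOn).add (hg.continuousOn_mul hUac.continuousOn)
  -- The difference of the product and of its would-be primitive is absolutely continuous with
  -- derivative zero almost everywhere.
  have hac : AbsolutelyContinuousOnInterval
      (U • V - fun x => ∫ t in a..x, (f t * V t + U t * g t)) a b :=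
    (hUac.smul hVac).sub (absolutelyContinuousOnInterval_integral hint)
  obtain ⟨C, hC⟩ := hac.const_of_ae_hasDerivAt_zero (by
    filter_upwards [hf.ae_hasDerivAt_integral, hg.ae_hasDerivAt_integral,
      hint.ae_hasDerivAt_integral] with x h1 h2 h3 hx
    have d1 : HasDerivAt U (f x) x := (h1 hx a left_mem_uIcc).const_add _
    have d2 : HasDerivAt V (g x) x := (h2 hx a left_mem_uIcc).const_add _
    have d3 := (d1.mul d2).sub (h3 hx a left_mem_uIcc)
    rw [sub_self] at d3
    exact d3)
  have h1 := hC a left_mem_uIcc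
  have h2 := hC b right_mem_uIcc
  simp only [Pi.sub_apply, smul_eq_mul, Pi.mul_apply, intervalIntegral.integral_same,
    sub_zero] at h1 h2
  have h3 : ∫ x in a..b, (f x * v x + u x * g x) = ∫ x in a..b, (f x * V x + U x * g x) := by
    apply intervalIntegral.integral_congr
    intro x hx
    rw [uIcc_of_le hab] at hx
    simp only [huU x hx, hvV x hx]
  rw [h3, huU a ⟨le_rfl, hab⟩, huU b ⟨hab, le_rfl⟩, hvV a ⟨le_rfl, hab⟩, hvV b ⟨hab, le_rfl⟩]
  linear_combination h1 - h2

/-! ### Chains of successive derivatives -/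

/-- `F 0, …, F m` are square integrable on `(a, b)`, and each of `F 0, …, F (m - 1)` is on `[a, b]`
an indefinite integral of the next one. This encodes a function `F 0 ∈ W^{m,2}(a, b)` together with
the continuous representatives of its derivatives of order less than `m` and a representative `F m`
of the highest one. -/
structure IsJet (a b : ℝ) (m : ℕ) (F : ℕ → ℝ → ℂ) : Prop where
  memLp : ∀ k ≤ m, MemLp (F k) 2 (volume.restrict (Ioo a b))
  sub_eq : ∀ k < m, ∀ x ∈ Icc a b, ∀ y ∈ Icc a b, F k y - F k x = ∫ t in x..y, F (k + 1) t

lemma intervalIntegrable_of_memLp {a b : ℝ} (hab : a ≤ b) {g : ℝ → ℂ}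
    (hg : MemLp g 2 (volume.restrict (Ioo a b))) : IntervalIntegrable g volume a b := by
  rw [intervalIntegrable_iff_integrableOn_Ioo_of_le hab]
  exact hg.integrable one_le_two

lemma memLp_of_continuousOn {a b : ℝ} {g : ℝ → ℂ} (hg : ContinuousOn g (Icc a b)) :
    MemLp g 2 (volume.restrict (Ioo a b)) := by
  obtain ⟨C, hC⟩ := isCompact_Icc.exists_bound_of_continuousOn hg
  refine MemLp.of_bound ((hg.mono Ioo_subset_Icc_self).aestronglyMeasurable measurableSet_Ioo) C ?_
  filter_upwards [ae_restrict_mem measurableSet_Ioo] with x hx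
  exact hC x (Ioo_subset_Icc_self hx)

section Jet

variable {a b : ℝ} {m : ℕ} {F G : ℕ → ℝ → ℂ}

lemma IsJet.intervalIntegrable (hF : IsJet a b m F) (hab : a ≤ b) {k : ℕ} (hk : k ≤ m) :
    IntervalIntegrable (F k) volume a b :=
  intervalIntegrable_of_memLp hab (hF.memLp k hk)

lemma IsJet.continuousOn (hF : IsJet a b m F) (hab : a ≤ b) {k : ℕ} (hk : k < m) :
    ContinuousOn (F k) (Icc a b) := by
  have h := intervalIntegral.continuousOn_primitive_interval' (hF.intervalIntegrable hab hk)
    (left_mem_uIcc)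
  rw [uIcc_of_le hab] at h
  refine ((continuousOn_const (c := F k a)).add h).congr fun x hx => ?_
  have h2 := hF.sub_eq k hk a ⟨le_rfl, hab⟩ x hx
  exact (add_eq_of_eq_sub' h2.symm).symm

lemma IsJet.mono (hF : IsJet a b m F) {l : ℕ} (hl : l ≤ m) : IsJet a b l F :=
  ⟨fun k hk => hF.memLp k (hk.trans hl), fun k hk => hF.sub_eq k (hk.trans_le hl)⟩

lemma IsJet.shift {j : ℕ} (hF : IsJet a b (m + j) F) : IsJet a b m fun k => F (k + j) :=
  ⟨fun k hk => hF.memLp (k + j) (by omega), fun k hk x hx y hy => by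
    rw [hF.sub_eq (k + j) (by omega) x hx y hy, add_right_comm]⟩

lemma IsJet.add (hab : a ≤ b) (hF : IsJet a b m F) (hG : IsJet a b m G) :
    IsJet a b m fun k x => F k x + G k x := by
  refine ⟨fun k hk => (hF.memLp k hk).add (hG.memLp k hk), fun k hk x hx y hy => ?_⟩
  have hs : uIcc x y ⊆ uIcc a b := by rw [uIcc_of_le hab]; exact uIcc_subset_Icc hx hy
  rw [intervalIntegral.integral_add ((hF.intervalIntegrable hab hk).mono_set hs)
    ((hG.intervalIntegrable hab hk).mono_set hs), ← hF.sub_eq k hk x hx y hy,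
    ← hG.sub_eq k hk x hx y hy]
  ring

lemma IsJet.const_mul (c : ℂ) (hF : IsJet a b m F) : IsJet a b m fun k x => c * F k x := by
  refine ⟨fun k hk => (hF.memLp k hk).const_mul c, fun k hk x hx y hy => ?_⟩
  rw [intervalIntegral.integral_const_mul, ← hF.sub_eq k hk x hx y hy]
  ring

lemma IsJet.sub (hab : a ≤ b) (hF : IsJet a b m F) (hG : IsJet a b m G) :
    IsJet a b m fun k x => F k x - G k x := by
  have h := hF.add hab (hG.const_mul (-1))
  simpa only [neg_one_mul, ← sub_eq_add_neg] using h

lemma IsJet.conj (hF : IsJet a b m F) :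
    IsJet a b m fun k x => (starRingEnd ℂ) (F k x) := by
  refine ⟨fun k hk => (hF.memLp k hk).star, fun k hk x hx y hy => ?_⟩
  rw [← map_sub, hF.sub_eq k hk x hx y hy, intervalIntegral.intervalIntegral_eq_integral_uIoc,
    intervalIntegral.intervalIntegral_eq_integral_uIoc, integral_conj, Complex.real_smul,
    Complex.real_smul, map_mul, Complex.conj_ofReal]

lemma isJet_of_contDiff {φ : ℝ → ℂ} (hφ : ContDiff ℝ ∞ φ) (a b : ℝ) (m : ℕ) :
    IsJet a b m fun k => iteratedDeriv k φ := by
  have hd : ∀ k, Differentiable ℝ (iteratedDeriv k φ) := fun k =>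
    hφ.differentiable_iteratedDeriv k (by exact_mod_cast WithTop.coe_lt_top _)
  refine ⟨fun k _ => memLp_of_continuousOn (hd k).continuous.continuousOn, fun k _ x _ y _ => ?_⟩
  rw [intervalIntegral.integral_eq_sub_of_hasDerivAt]
  · intro t _
    rw [iteratedDeriv_succ]
    exact (hd k t).hasDerivAt
  · exact (hd (k + 1)).continuous.intervalIntegrable _ _

/-- The chain with prescribed values at a point `c` and prescribed last function `g`: integrate
`g` repeatedly, starting from `c`. -/
lemma exists_isJet (hab : a ≤ b) {c : ℝ} (hc : c ∈ Icc a b) (m : ℕ) (d : ℕ → ℂ) {g : ℝ → ℂ}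
    (hg : MemLp g 2 (volume.restrict (Ioo a b))) :
    ∃ F, IsJet a b m F ∧ F m = g ∧ ∀ k < m, F k c = d k := by
  induction m generalizing d with
  | zero =>
    exact ⟨fun _ => g, ⟨fun k _ => hg, fun k hk => absurd hk (Nat.not_lt_zero k)⟩, rfl,
      fun k hk => absurd hk (Nat.not_lt_zero k)⟩
  | succ m ih =>
    obtain ⟨F, hF, hFm, hFc⟩ := ih fun k => d (k + 1)
    have hint := hF.intervalIntegrable hab (Nat.zero_le m)
    have hsub : ∀ {x y : ℝ}, x ∈ Icc a b → y ∈ Icc a b →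
        IntervalIntegrable (F 0) volume x y := fun hx hy =>
      hint.mono_set (by rw [uIcc_of_le hab]; exact uIcc_subset_Icc hx hy)
    have hcont : ContinuousOn (fun x => d 0 + ∫ t in c..x, F 0 t) (Icc a b) := by
      have h := intervalIntegral.continuousOn_primitive_interval' hint
        (show c ∈ uIcc a b by rwa [uIcc_of_le hab])
      rw [uIcc_of_le hab] at h
      exact continuousOn_const.add h
    refine ⟨fun k => Nat.casesOn k (fun x => d 0 + ∫ t in c..x, F 0 t) F, ⟨?_, ?_⟩, hFm, ?_⟩
    · rintro (_ | k) hk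
      · exact memLp_of_continuousOn hcont
      · exact hF.memLp k (by omega)
    · rintro (_ | k) hk x hx y hy
      · change d 0 + (∫ t in c..y, F 0 t) - (d 0 + ∫ t in c..x, F 0 t) = ∫ t in x..y, F 0 t
        rw [← intervalIntegral.integral_interval_sub_left (hsub hc hy) (hsub hc hx)]
        ring
      · exact hF.sub_eq k (by omega) x hx y hy
    · rintro (_ | k) hk
      · change d 0 + (∫ t in c..c, F 0 t) = d 0
        rw [intervalIntegral.integral_same, add_zero]
      · exact hFc k (by omega)

/-- Repeated integration by parts. -/
lemma IsJet.integral_mul_eq (hab : a ≤ b) (hF : IsJet a b m F) (hG : IsJet a b m G) :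
    ∫ x in a..b, F m x * G 0 x
      = ∑ k ∈ Finset.range m, (-1 : ℂ) ^ k *
          (F (m - 1 - k) b * G k b - F (m - 1 - k) a * G k a)
        + (-1 : ℂ) ^ m * ∫ x in a..b, F 0 x * G m x := by
  induction m generalizing G with
  | zero => simp
  | succ m ih =>
    have ha : a ∈ Icc a b := ⟨le_rfl, hab⟩
    have h1 := integral_mul_add_mul_eq_sub (u := F m) (v := G 0) hab
      (hF.intervalIntegrable hab le_rfl) (hG.intervalIntegrable hab (Nat.succ_le_succ m.zero_le))
      (hF.sub_eq m m.lt_succ_self a ha) (hG.sub_eq 0 m.succ_pos a ha)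
    have hmem : ∀ {u v : ℝ → ℂ}, MemLp u 2 (volume.restrict (Ioo a b)) →
        MemLp v 2 (volume.restrict (Ioo a b)) →
        IntervalIntegrable (fun x => u x * v x) volume a b := fun hu hv => by
      rw [intervalIntegrable_iff_integrableOn_Ioo_of_le hab]
      exact hu.integrable_mul hv
    rw [intervalIntegral.integral_add
      (hmem (hF.memLp _ le_rfl) (hG.memLp 0 (Nat.zero_le _)))
      (hmem (hF.memLp m m.le_succ) (hG.memLp 1 (Nat.succ_le_succ m.zero_le)))] at h1
    have h2 := ih (hF.mono m.le_succ) hG.shift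
    simp only [zero_add] at h2 h1
    rw [Finset.sum_range_succ', eq_sub_of_add_eq h1, h2]
    simp only [pow_succ, pow_zero, Nat.add_sub_cancel, Nat.sub_zero, Nat.sub_sub]
    simp only [mul_neg, mul_one, neg_mul, Finset.sum_neg_distrib]
    ring_nf

end Jet

/-! ### Test functions -/

section Test

variable {a b : ℝ}

lemma IsTest.deriv {φ : ℝ → ℂ} (h : IsTest a b φ) : IsTest a b (deriv φ) :=
  ⟨(contDiff_infty_iff_deriv.1 h.smooth).2, h.compact.deriv,
    tsupport_deriv_subset.trans h.support⟩

lemma IsTest.iteratedDeriv {φ : ℝ → ℂ} (h : IsTest a b φ) (k : ℕ) :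
    IsTest a b (iteratedDeriv k φ) := by
  induction k with
  | zero => rwa [iteratedDeriv_zero]
  | succ k ih => rw [iteratedDeriv_succ]; exact ih.deriv

lemma IsTest.eq_zero {φ : ℝ → ℂ} (h : IsTest a b φ) {x : ℝ} (hx : x ∉ Ioo a b) : φ x = 0 :=
  image_eq_zero_of_notMem_tsupport fun hx' => hx (h.support hx')

lemma IsTest.left {φ : ℝ → ℂ} (h : IsTest a b φ) : φ a = 0 := h.eq_zero left_notMem_Ioo

lemma IsTest.right {φ : ℝ → ℂ} (h : IsTest a b φ) : φ b = 0 := h.eq_zero right_notMem_Ioo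

lemma IsTest.conj {φ : ℝ → ℂ} (h : IsTest a b φ) :
    IsTest a b fun x => (starRingEnd ℂ) (φ x) := by
  have hsupp : Function.support (fun x => (starRingEnd ℂ) (φ x)) = Function.support φ := by
    ext x
    simp
  refine ⟨Complex.conjCLE.contDiff.comp h.smooth, ?_, ?_⟩
  · rw [HasCompactSupport, tsupport, hsupp]; exact h.compact
  · rw [tsupport, hsupp]; exact h.support

lemma iteratedDeriv_conj {φ : ℝ → ℂ} (h : ContDiff ℝ ∞ φ) (k : ℕ) :
    iteratedDeriv k (fun x => (starRingEnd ℂ) (φ x))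
      = fun x => (starRingEnd ℂ) (iteratedDeriv k φ x) := by
  induction k with
  | zero => simp
  | succ k ih =>
    funext x
    rw [iteratedDeriv_succ, ih, iteratedDeriv_succ]
    have hd : Differentiable ℝ (iteratedDeriv k φ) :=
      h.differentiable_iteratedDeriv k (by exact_mod_cast WithTop.coe_lt_top _)
    have := (Complex.conjCLE.toContinuousLinearMap.hasFDerivAt.comp_hasDerivAt x
      (hd x).hasDerivAt)
    exact this.deriv

lemma IsTest.integrableOn_mul {φ g : ℝ → ℂ} (h : IsTest a b φ) (hg : IntegrableOn g (Ioo a b)) :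
    IntegrableOn (fun x => g x * φ x) (Ioo a b) := by
  obtain ⟨C, hC⟩ := h.compact.exists_bound_of_continuous h.smooth.continuous
  exact hg.mul_bdd h.smooth.continuous.aestronglyMeasurable (ae_of_all _ hC)

/-- A test function with integral zero has a primitive which is a test function. -/
lemma IsTest.exists_primitive (hab : a < b) {ψ : ℝ → ℂ} (h : IsTest a b ψ)
    (h0 : ∫ x in a..b, ψ x = 0) : ∃ Ψ : ℝ → ℂ, IsTest a b Ψ ∧ ∀ x, HasDerivAt Ψ (ψ x) x := by
  have hcont := h.smooth.continuous
  -- A compact interval `[c, d]` inside `(a, b)` that contains the support; the midpoint is added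
  -- because the support may be empty.
  have hK : IsCompact (insert ((a + b) / 2) (tsupport ψ)) := IsCompact.insert h.compact _
  have hKs : insert ((a + b) / 2) (tsupport ψ) ⊆ Ioo a b :=
    insert_subset ⟨by linarith, by linarith⟩ h.support
  obtain ⟨c, hc, hcl⟩ := hK.exists_isLeast (insert_nonempty _ _)
  obtain ⟨d, hd, hdg⟩ := hK.exists_isGreatest (insert_nonempty _ _)
  have hz : ∀ x, x ∉ Icc c d → ψ x = 0 := fun x hx =>
    image_eq_zero_of_notMem_tsupport fun hx' =>
      hx ⟨hcl (mem_insert_of_mem _ hx'), hdg (mem_insert_of_mem _ hx')⟩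
  have hder : ∀ x, HasDerivAt (fun x => ∫ t in a..x, ψ t) (ψ x) x := fun x =>
    intervalIntegral.integral_hasDerivAt_right (hcont.intervalIntegrable _ _)
      (hcont.stronglyMeasurableAtFilter _ _) hcont.continuousAt
  have hzero : ∀ x, x ∉ Icc c d → ∫ t in a..x, ψ t = 0 := by
    intro x hx
    rcases lt_or_ge x c with hxc | hxc
    · rw [← intervalIntegral.integral_zero (a := a) (b := x) (μ := volume)]
      refine intervalIntegral.integral_congr fun t ht => hz t fun ht' => ?_
      rcases mem_uIcc.1 ht with h1 | h1 <;> linarith [ht'.1, (hKs hc).1]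
    · have hxd : d < x := by
        by_contra hxd
        exact hx ⟨hxc, not_lt.1 hxd⟩
      have h2 : ∫ t in b..x, ψ t = 0 := by
        rw [← intervalIntegral.integral_zero (a := b) (b := x) (μ := volume)]
        refine intervalIntegral.integral_congr fun t ht => hz t fun ht' => ?_
        rcases mem_uIcc.1 ht with h1 | h1 <;> linarith [ht'.2, (hKs hd).2]
      rw [← intervalIntegral.integral_add_adjacent_intervals
        (hcont.intervalIntegrable a b) (hcont.intervalIntegrable b x), h0, h2, add_zero]
  have hsupp : tsupport (fun x => ∫ t in a..x, ψ t) ⊆ Icc c d :=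
    closure_minimal (fun x hx => by
      by_contra hx'
      exact hx (hzero x hx')) isClosed_Icc
  refine ⟨fun x => ∫ t in a..x, ψ t, ⟨?_, ?_, ?_⟩, hder⟩
  · rw [contDiff_infty_iff_deriv]
    refine ⟨fun x => (hder x).differentiableAt, ?_⟩
    rw [show _root_.deriv (fun x => ∫ t in a..x, ψ t) = ψ from funext fun x => (hder x).deriv]
    exact h.smooth
  · exact isCompact_Icc.of_isClosed_subset (isClosed_tsupport _) hsupp
  · exact hsupp.trans fun x hx => ⟨(hKs hc).1.trans_le hx.1, hx.2.trans_lt (hKs hd).2⟩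

lemma integral_Ioo_eq_intervalIntegral (hab : a ≤ b) (g : ℝ → ℂ) :
    ∫ x in Ioo a b, g x = ∫ x in a..b, g x := by
  rw [intervalIntegral.integral_of_le hab, integral_Ioc_eq_integral_Ioo]

/-- A test function whose moments of order less than `m` vanish is the derivative of order `m` of a
test function. -/
lemma IsTest.exists_iteratedDeriv_eq (hab : a < b) (m : ℕ) {ψ : ℝ → ℂ} (h : IsTest a b ψ)
    (h0 : ∀ j < m, ∫ x in a..b, (x : ℂ) ^ j * ψ x = 0) :
    ∃ φ, IsTest a b φ ∧ _root_.iteratedDeriv m φ = ψ := by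
  induction m generalizing ψ with
  | zero => exact ⟨ψ, h, iteratedDeriv_zero⟩
  | succ m ih =>
    obtain ⟨Ψ, hΨ, hder⟩ := h.exists_primitive hab (by simpa using h0 0 m.succ_pos)
    have hmom : ∀ j < m, ∫ x in a..b, (x : ℂ) ^ j * Ψ x = 0 := by
      intro j hj
      have hpow : ∀ x : ℝ, HasDerivAt (fun x : ℝ => (x : ℂ) ^ (j + 1))
          (((j + 1 : ℕ) : ℂ) * (x : ℂ) ^ j) x := fun x => by
        have := (hasDerivAt_pow (j + 1) (x : ℂ)).comp_ofReal
        simpa using this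
      have hip := intervalIntegral.integral_deriv_mul_eq_sub (a := a) (b := b)
        (fun x _ => hpow x) (fun x _ => hder x)
        (by apply Continuous.intervalIntegrable; fun_prop)
        (h.smooth.continuous.intervalIntegrable a b)
      rw [hΨ.left, hΨ.right, intervalIntegral.integral_add
        (by apply Continuous.intervalIntegrable; have := hΨ.smooth.continuous; fun_prop)
        (by apply Continuous.intervalIntegrable; have := h.smooth.continuous; fun_prop),
        h0 (j + 1) (by omega)] at hip
      simp only [mul_assoc, intervalIntegral.integral_const_mul, mul_zero, sub_zero,
        add_zero] at hip
      exact (mul_eq_zero.1 hip).resolve_left (Nat.cast_ne_zero.2 j.succ_ne_zero)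
    obtain ⟨φ, hφ, hφm⟩ := ih hΨ hmom
    refine ⟨φ, hφ, ?_⟩
    rw [iteratedDeriv_succ, hφm]
    exact funext fun x => (hder x).deriv

/-- The fundamental lemma of the calculus of variations on `(a, b)`. -/
lemma ae_eq_zero_of_forall_integral_isTest {g : ℝ → ℂ} (hg : IntegrableOn g (Ioo a b))
    (h : ∀ φ, IsTest a b φ → ∫ x in Ioo a b, g x * φ x = 0) :
    g =ᵐ[volume.restrict (Ioo a b)] 0 := by
  have := isOpen_Ioo.ae_eq_zero_of_integral_contDiff_smul_eq_zero hg.locallyIntegrableOn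
    (fun χ hχ hχc hχs => by
      have hsupp : Function.support (fun x => (χ x : ℂ)) = Function.support χ := by
        ext x
        simp
      have hT : IsTest a b fun x => (χ x : ℂ) := by
        refine ⟨Complex.ofRealCLM.contDiff.comp hχ, ?_, ?_⟩
        · rw [HasCompactSupport, tsupport, hsupp]; exact hχc
        · rw [tsupport, hsupp]; exact hχs
      rw [← h _ hT, ← setIntegral_eq_integral_of_forall_compl_eq_zero (s := Ioo a b)]
      · refine integral_congr_ae (ae_of_all _ fun x => ?_)
        simp only [Complex.real_smul, mul_comm]
      · intro x hx
        have := hT.eq_zero hx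
        rw [Complex.ofReal_eq_zero.1 this, zero_smul])
  rw [Filter.EventuallyEq, ae_restrict_iff' measurableSet_Ioo]
  exact this

/-- The space of test functions. -/
def testSpace (a b : ℝ) : Submodule ℂ (ℝ → ℂ) where
  carrier := {φ | IsTest a b φ}
  zero_mem' := IsTest.zero a b
  add_mem' := IsTest.add
  smul_mem' := fun c _ h => h.const_smul c

/-- The functional `φ ↦ ∫ g φ` on the test functions. -/
noncomputable def testPairing {g : ℝ → ℂ} (hg : IntegrableOn g (Ioo a b)) :
    testSpace a b →ₗ[ℂ] ℂ where
  toFun φ := ∫ x in Ioo a b, g x * (φ : ℝ → ℂ) x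
  map_add' φ ψ := by
    rw [← integral_add (φ.2.integrableOn_mul hg) (ψ.2.integrableOn_mul hg)]
    simp only [Submodule.coe_add, Pi.add_apply, mul_add]
  map_smul' c φ := by
    rw [RingHom.id_apply, smul_eq_mul, ← integral_const_mul]
    simp only [Submodule.coe_smul, Pi.smul_apply, smul_eq_mul, mul_left_comm]

/-- The lemma of du Bois-Reymond: as a functional on the test functions, `g` vanishes where the
moments of order less than `m` do, so that it is a linear combination of them. -/
lemma exists_polynomial_ae_eq (hab : a < b) (m : ℕ) {g : ℝ → ℂ} (hg : IntegrableOn g (Ioo a b))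
    (h : ∀ φ, IsTest a b φ → ∫ x in Ioo a b, g x * iteratedDeriv m φ x = 0) :
    ∃ p : Polynomial ℂ, p.degree < m ∧
      g =ᵐ[volume.restrict (Ioo a b)] fun x => p.eval (x : ℂ) := by
  have hpow : ∀ j : ℕ, IntegrableOn (fun x : ℝ => (x : ℂ) ^ j) (Ioo a b) := fun j =>
    (Continuous.integrableOn_Icc (by fun_prop)).mono_set Ioo_subset_Icc_self
  have hker : ⨅ j : Fin m, LinearMap.ker (testPairing (hpow j))
      ≤ LinearMap.ker (testPairing hg) := by
    intro ψ hψ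
    obtain ⟨φ, hφ, hφm⟩ := IsTest.exists_iteratedDeriv_eq hab m ψ.2 fun j hj => by
      have := (Submodule.mem_iInf _).1 hψ ⟨j, hj⟩
      rw [← integral_Ioo_eq_intervalIntegral hab.le]
      exact this
    have := h φ hφ
    rw [hφm] at this
    exact this
  obtain ⟨c, hc⟩ := (Submodule.mem_span_range_iff_exists_fun ℂ).1
    (mem_span_of_iInf_ker_le_ker hker)
  refine ⟨∑ j : Fin m, Polynomial.C (c j) * Polynomial.X ^ (j : ℕ),
    Polynomial.degree_sum_fin_lt c, ?_⟩
  have hp : IntegrableOn (fun x : ℝ => ∑ j : Fin m, c j * (x : ℂ) ^ (j : ℕ)) (Ioo a b) :=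
    integrable_finsetSum _ fun j _ => (hpow j).const_mul (c j)
  have h0 := ae_eq_zero_of_forall_integral_isTest (hg.sub hp) fun φ hφ => by
    have h1 := LinearMap.congr_fun hc (⟨φ, hφ⟩ : testSpace a b)
    simp only [LinearMap.sum_apply, LinearMap.smul_apply, smul_eq_mul] at h1
    have h2 : ∫ x in Ioo a b, (∑ j : Fin m, c j * (x : ℂ) ^ (j : ℕ)) * φ x
        = ∑ j : Fin m, c j * ∫ x in Ioo a b, (x : ℂ) ^ (j : ℕ) * φ x := by
      simp only [Finset.sum_mul, mul_assoc]
      rw [integral_finsetSum _ fun (j : Fin m) _ =>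
        (hφ.integrableOn_mul (hpow j)).const_mul (c j)]
      simp only [integral_const_mul]
    simp only [Pi.sub_apply, sub_mul]
    rw [integral_sub (hφ.integrableOn_mul hg) (hφ.integrableOn_mul hp), h2, sub_eq_zero]
    exact h1.symm
  filter_upwards [h0] with x hx
  simpa [Polynomial.eval_finsetSum] using sub_eq_zero.1 hx

end Test

/-! ### Polynomials as functions on the line -/

lemma iteratedDeriv_eval_ofReal (p : Polynomial ℂ) (k : ℕ) :
    iteratedDeriv k (fun x : ℝ => p.eval (x : ℂ))
      = fun x : ℝ => (Polynomial.derivative^[k] p).eval (x : ℂ) := by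
  induction k with
  | zero => simp
  | succ k ih =>
    funext x
    rw [iteratedDeriv_succ, ih, Function.iterate_succ_apply']
    exact ((Polynomial.derivative^[k] p).hasDerivAt (x : ℂ)).comp_ofReal.deriv

lemma contDiff_eval_ofReal (p : Polynomial ℂ) : ContDiff ℝ ∞ fun x : ℝ => p.eval (x : ℂ) := by
  have h : ContDiff ℝ ∞ fun z : ℂ => p.eval z := by
    have := p.contDiff_aeval (𝕜 := ℂ) (R := ℂ) (n := ∞)
    simp only [Polynomial.coe_aeval_eq_eval] at this
    exact this.restrict_scalars ℝ
  exact h.comp Complex.ofRealCLM.contDiff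

/-- A polynomial with prescribed derivatives at a point. -/
lemma exists_polynomial_iterate_derivative_eval (m : ℕ) (z : ℂ) (d : ℕ → ℂ) :
    ∃ p : Polynomial ℂ, ∀ k < m, (Polynomial.derivative^[k] p).eval z = d k := by
  refine ⟨Polynomial.taylor (-z) (∑ j ∈ Finset.range m,
    Polynomial.C (d j / (j.factorial : ℂ)) * Polynomial.X ^ j), fun k hk => ?_⟩
  have h := Polynomial.taylor_coeff (r := z) (f := Polynomial.taylor (-z) (∑ j ∈ Finset.range m,
    Polynomial.C (d j / (j.factorial : ℂ)) * Polynomial.X ^ j)) k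
  rw [Polynomial.taylor_taylor, add_neg_cancel, Polynomial.taylor_zero] at h
  rw [← Polynomial.factorial_smul_hasseDeriv, LinearMap.smul_apply, Polynomial.eval_smul, ← h]
  simp only [Polynomial.finsetSum_coeff, Polynomial.coeff_C_mul, Polynomial.coeff_X_pow,
    mul_ite, mul_one, mul_zero, Finset.sum_ite_eq, Finset.mem_range, hk, if_true, nsmul_eq_mul]
  exact mul_div_cancel₀ _ (Nat.cast_ne_zero.2 k.factorial_ne_zero)

/-! ### Weak derivatives and chains -/

section Weak

variable {a b : ℝ}

lemma integrableOn_L2 (f : L2 a b) : IntegrableOn f (Ioo a b) :=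
  (Lp.memLp f).integrable one_le_two

lemma HasWeakDeriv.unique {k : ℕ} {f g g' : L2 a b} (h : HasWeakDeriv k f g)
    (h' : HasWeakDeriv k f g') : g = g' := by
  have h0 := ae_eq_zero_of_forall_integral_isTest ((integrableOn_L2 g).sub (integrableOn_L2 g'))
    fun φ hφ => by
      simp only [Pi.sub_apply, sub_mul]
      rw [integral_sub (hφ.integrableOn_mul (integrableOn_L2 g))
        (hφ.integrableOn_mul (integrableOn_L2 g')), sub_eq_zero]
      exact mul_left_cancel₀ (pow_ne_zero k (neg_ne_zero.2 one_ne_zero))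
        ((h φ hφ).symm.trans (h' φ hφ))
  apply Lp.ext
  filter_upwards [h0] with x hx
  exact sub_eq_zero.1 hx

/-- The chain `F` is that of the class `f`. -/
structure IsJetOf (m : ℕ) (f : L2 a b) (F : ℕ → ℝ → ℂ) : Prop where
  isJet : IsJet a b m F
  ae_eq : f =ᵐ[volume.restrict (Ioo a b)] F 0

variable {m : ℕ} {f g : L2 a b} {F G : ℕ → ℝ → ℂ}

lemma IsJet.isJetOf (hF : IsJet a b m F) : IsJetOf m ((hF.memLp 0 m.zero_le).toLp (F 0)) F :=
  ⟨hF, MemLp.coeFn_toLp _⟩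

lemma IsJetOf.add (hab : a ≤ b) (hF : IsJetOf m f F) (hG : IsJetOf m g G) :
    IsJetOf m (f + g) fun k x => F k x + G k x := by
  refine ⟨hF.isJet.add hab hG.isJet, ?_⟩
  filter_upwards [Lp.coeFn_add f g, hF.ae_eq, hG.ae_eq] with x h h1 h2
  rw [h, Pi.add_apply, h1, h2]

lemma IsJetOf.const_smul (c : ℂ) (hF : IsJetOf m f F) :
    IsJetOf m (c • f) fun k x => c * F k x := by
  refine ⟨hF.isJet.const_mul c, ?_⟩
  filter_upwards [Lp.coeFn_smul c f, hF.ae_eq] with x h h1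
  rw [h, Pi.smul_apply, h1, smul_eq_mul]

lemma IsJetOf.sub (hab : a ≤ b) (hF : IsJetOf m f F) (hG : IsJetOf m g G) :
    IsJetOf m (f - g) fun k x => F k x - G k x := by
  refine ⟨hF.isJet.sub hab hG.isJet, ?_⟩
  filter_upwards [Lp.coeFn_sub f g, hF.ae_eq, hG.ae_eq] with x h h1 h2
  rw [h, Pi.sub_apply, h1, h2]

lemma setIntegral_mul_congr {u v : ℝ → ℂ} (h : u =ᵐ[volume.restrict (Ioo a b)] v) (φ : ℝ → ℂ) :
    ∫ x in Ioo a b, u x * φ x = ∫ x in Ioo a b, v x * φ x :=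
  integral_congr_ae (by filter_upwards [h] with x hx; rw [hx])

/-- The functions of a chain are weak derivatives of the first one. -/
lemma IsJetOf.hasWeakDeriv (hab : a ≤ b) (hF : IsJetOf m f F) {k : ℕ} (hk : k ≤ m)
    (hg : g =ᵐ[volume.restrict (Ioo a b)] F k) : HasWeakDeriv k f g := by
  intro φ hφ
  have h := (hF.isJet.mono hk).integral_mul_eq hab (isJet_of_contDiff hφ.smooth a b k)
  have hz : ∀ j, iteratedDeriv j φ a = 0 ∧ iteratedDeriv j φ b = 0 := fun j =>
    ⟨(hφ.iteratedDeriv j).left, (hφ.iteratedDeriv j).right⟩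
  simp only [hz, mul_zero, sub_zero, Finset.sum_const_zero, zero_add, iteratedDeriv_zero] at h
  rw [setIntegral_mul_congr hF.ae_eq, setIntegral_mul_congr hg,
    integral_Ioo_eq_intervalIntegral hab, integral_Ioo_eq_intervalIntegral hab, h, ← mul_assoc,
    ← mul_pow, neg_one_mul, neg_neg, one_pow, one_mul]

/-- A function with a weak derivative `g` of order `m` differs by a polynomial from an `m`-fold
primitive of `g`, hence belongs to a chain. -/
lemma HasWeakDeriv.exists_isJetOf (hab : a < b) (h : HasWeakDeriv m f g) :
    ∃ F, IsJetOf m f F ∧ F m = g := by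
  obtain ⟨G, hG, hGm, -⟩ := exists_isJet hab.le (left_mem_Icc.2 hab.le) m 0 (Lp.memLp g)
  have hG0 : IntegrableOn (G 0) (Ioo a b) := (hG.memLp 0 m.zero_le).integrable one_le_two
  obtain ⟨p, hp, hfp⟩ := exists_polynomial_ae_eq hab m ((integrableOn_L2 f).sub hG0) fun φ hφ => by
    have hGf := hG.isJetOf
    have hw : HasWeakDeriv m ((hG.memLp 0 m.zero_le).toLp (G 0)) g :=
      hGf.hasWeakDeriv hab.le le_rfl (by rw [hGm])
    have h1 := hw φ hφ
    rw [setIntegral_mul_congr hGf.ae_eq, ← h φ hφ] at h1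
    simp only [Pi.sub_apply, sub_mul]
    rw [integral_sub ((hφ.iteratedDeriv m).integrableOn_mul (integrableOn_L2 f))
      ((hφ.iteratedDeriv m).integrableOn_mul hG0), h1, sub_self]
  have hP := isJet_of_contDiff (contDiff_eval_ofReal p) a b m
  refine ⟨_, ⟨hG.add hab.le hP, ?_⟩, ?_⟩
  · filter_upwards [hfp] with x hx
    rw [iteratedDeriv_zero, ← hx, Pi.sub_apply]
    ring
  · funext x
    rw [hGm, iteratedDeriv_eval_ofReal, Polynomial.iterate_derivative_eq_zero_of_degree_lt hp]
    simp only [Polynomial.eval_zero, add_zero]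

lemma mem_sobolev_iff (hab : a < b) : f ∈ sobolev a b m ↔ ∃ F, IsJetOf m f F := by
  constructor
  · intro h
    obtain ⟨g, hg⟩ := h m le_rfl
    obtain ⟨F, hF, -⟩ := hg.exists_isJetOf hab
    exact ⟨F, hF⟩
  · rintro ⟨F, hF⟩ k hk
    exact ⟨(hF.isJet.memLp k hk).toLp (F k),
      hF.hasWeakDeriv hab.le hk (MemLp.coeFn_toLp _)⟩

lemma HasWeakDeriv.weakDeriv_eq {k : ℕ} (h : HasWeakDeriv k f g) : weakDeriv k f = g := by
  have hex : ∃ g, HasWeakDeriv k f g := ⟨g, h⟩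
  rw [weakDeriv, dif_pos hex]
  exact hex.choose_spec.unique h

lemma IsJetOf.weakDeriv_ae_eq (hab : a ≤ b) (hF : IsJetOf m f F) {k : ℕ} (hk : k ≤ m) :
    weakDeriv k f =ᵐ[volume.restrict (Ioo a b)] F k := by
  rw [(hF.hasWeakDeriv hab hk (MemLp.coeFn_toLp (hF.isJet.memLp k hk))).weakDeriv_eq]
  exact MemLp.coeFn_toLp _

lemma value_eq (hab : a < b) {u : ℝ → ℂ} (hu : ContinuousOn u (Icc a b))
    (hfu : f =ᵐ[volume.restrict (Ioo a b)] u) {x : ℝ} (hx : x ∈ Icc a b) : value f x = u x := by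
  have hex : ∃ F : ℝ → ℂ, ContinuousOn F (Icc a b) ∧ f =ᵐ[volume.restrict (Ioo a b)] F :=
    ⟨u, hu, hfu⟩
  rw [value, dif_pos hex]
  obtain ⟨h1, h2⟩ := hex.choose_spec
  have heq : EqOn hex.choose u (Ioo a b) :=
    Measure.eqOn_open_of_ae_eq (h2.symm.trans hfu) isOpen_Ioo (h1.mono Ioo_subset_Icc_self)
      (hu.mono Ioo_subset_Icc_self)
  exact heq.of_subset_closure h1 hu Ioo_subset_Icc_self (closure_Ioo hab.ne).ge hx

lemma IsJetOf.derivValue_eq (hab : a < b) (hF : IsJetOf m f F) {k : ℕ} (hk : k < m) {x : ℝ}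
    (hx : x ∈ Icc a b) : derivValue f k x = F k x :=
  value_eq hab (hF.isJet.continuousOn hab.le hk) (hF.weakDeriv_ae_eq hab.le hk.le) hx

end Weak

/-! ### The adjoint of the minimal operator -/

section Adjoint

variable {n : ℕ} {a b : ℝ}

lemma inner_eq_integral (hab : a ≤ b) {f g : L2 a b} {u v : ℝ → ℂ}
    (hf : f =ᵐ[volume.restrict (Ioo a b)] u) (hg : g =ᵐ[volume.restrict (Ioo a b)] v) :
    inner ℂ f g = ∫ x in a..b, v x * (starRingEnd ℂ) (u x) := by
  rw [L2.inner_def, ← integral_Ioo_eq_intervalIntegral hab]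
  refine integral_congr_ae ?_
  filter_upwards [hf, hg] with x h1 h2
  rw [RCLike.inner_apply, h1, h2]

lemma preminimalOp_graph (n : ℕ) (a b : ℝ) : (preminimalOp n a b).graph = preminimalGraph n a b :=
  Submodule.toLinearPMap_graph_eq _ fun p hp h0 => preminimalGraph_functional n a b p hp h0

/-- For a test function `φ` the pair of the classes of `φ` and `(-1)ⁿ φ^{(2n)}` is in the graph of
the minimal operator. -/
lemma exists_mem_preminimalGraph (n : ℕ) {φ : ℝ → ℂ} (hφ : IsTest a b φ) :
    ∃ p ∈ preminimalGraph n a b, p.1 =ᵐ[volume.restrict (Ioo a b)] φ ∧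
      p.2 =ᵐ[volume.restrict (Ioo a b)] fun x => (-1 : ℂ) ^ n * iteratedDeriv (2 * n) φ x := by
  have hm : ∀ {ψ : ℝ → ℂ}, IsTest a b ψ → MemLp ψ 2 (volume.restrict (Ioo a b)) := fun hψ =>
    memLp_of_continuousOn hψ.smooth.continuous.continuousOn
  have h1 := hm hφ
  have h2 := (hm (hφ.iteratedDeriv (2 * n))).const_mul ((-1 : ℂ) ^ n)
  exact ⟨(h1.toLp _, h2.toLp _), ⟨φ, hφ, h1.coeFn_toLp, h2.coeFn_toLp⟩, h1.coeFn_toLp,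
    h2.coeFn_toLp⟩

lemma preminimalOp_dense (n : ℕ) (hab : a ≤ b) :
    Dense ((preminimalOp n a b).domain : Set (L2 a b)) := by
  rw [Submodule.dense_iff_topologicalClosure_eq_top, Submodule.topologicalClosure_eq_top_iff,
    Submodule.eq_bot_iff]
  intro f hf
  have h0 := ae_eq_zero_of_forall_integral_isTest (integrableOn_L2 f) fun φ hφ => by
    obtain ⟨p, hp, hp1, -⟩ := exists_mem_preminimalGraph n hφ.conj
    rw [← preminimalOp_graph] at hp
    have h1 := (Submodule.mem_orthogonal _ _).1 hf p.1
      (LinearPMap.mem_domain_of_mem_graph hp)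
    rw [inner_eq_integral hab hp1 (Filter.EventuallyEq.refl _ _)] at h1
    simpa only [Complex.conj_conj, ← integral_Ioo_eq_intervalIntegral hab] using h1
  exact Lp.eq_zero_iff_ae_eq_zero.2 h0

lemma hasWeakDeriv_iff_forall_mem_preminimalGraph (hab : a ≤ b) {f g : L2 a b} :
    HasWeakDeriv (2 * n) f ((-1 : ℂ) ^ n • g) ↔
      ∀ p ∈ preminimalGraph n a b, inner ℂ g p.1 = inner ℂ f p.2 := by
  have hconj : ∀ u v : ℝ → ℂ, (starRingEnd ℂ) (∫ x in a..b, v x * (starRingEnd ℂ) (u x))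
      = ∫ x in Ioo a b, u x * (starRingEnd ℂ) (v x) := by
    intro u v
    rw [← integral_Ioo_eq_intervalIntegral hab, ← integral_conj]
    simp only [map_mul, Complex.conj_conj, mul_comm]
  have hpow : (-1 : ℂ) ^ (2 * n) = 1 := by rw [pow_mul, neg_one_sq, one_pow]
  have hsq : (-1 : ℂ) ^ n * (-1 : ℂ) ^ n = 1 := by rw [← mul_pow]; norm_num
  have key : ∀ φ, IsTest a b φ → ∀ p : L2 a b × L2 a b, p.1 =ᵐ[volume.restrict (Ioo a b)] φ →
      p.2 =ᵐ[volume.restrict (Ioo a b)] (fun x => (-1 : ℂ) ^ n * iteratedDeriv (2 * n) φ x) →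
      (inner ℂ g p.1 = inner ℂ f p.2 ↔
        ∫ x in Ioo a b, f x * iteratedDeriv (2 * n) (fun x => (starRingEnd ℂ) (φ x)) x
          = (-1 : ℂ) ^ (2 * n) *
            ∫ x in Ioo a b, ((-1 : ℂ) ^ n • g : L2 a b) x * (starRingEnd ℂ) (φ x)) := by
    intro φ hφ p h1 h2
    rw [inner_eq_integral hab (Filter.EventuallyEq.refl _ _) h1,
      inner_eq_integral hab (Filter.EventuallyEq.refl _ _) h2,
      ← (starRingEnd ℂ).injective.eq_iff, hconj, hconj, iteratedDeriv_conj hφ.smooth, hpow,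
      one_mul, setIntegral_mul_congr (Lp.coeFn_smul ((-1 : ℂ) ^ n) g)]
    simp only [map_mul, map_pow, map_neg, map_one, Pi.smul_apply, smul_eq_mul, mul_assoc,
      integral_const_mul]
    simp only [mul_left_comm _ ((-1 : ℂ) ^ n), integral_const_mul]
    constructor
    · intro h
      rw [h, ← mul_assoc, hsq, one_mul]
    · intro h
      rw [h, ← mul_assoc, hsq, one_mul]
  constructor
  · rintro h p ⟨φ, hφ, h1, h2⟩
    exact (key φ hφ p h1 h2).2 (h _ hφ.conj)
  · intro h φ hφ
    obtain ⟨p, hp, h1, h2⟩ := exists_mem_preminimalGraph n hφ.conj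
    have := (key _ hφ.conj p h1 h2).1 (h p hp)
    simpa only [Complex.conj_conj] using this

lemma mem_preminimalGraph_hasWeakDeriv (hab : a ≤ b) {p : L2 a b × L2 a b}
    (hp : p ∈ preminimalGraph n a b) : HasWeakDeriv (2 * n) p.1 ((-1 : ℂ) ^ n • p.2) := by
  obtain ⟨φ, hφ, h1, h2⟩ := hp
  have hF : IsJetOf (2 * n) p.1 fun k => iteratedDeriv k φ :=
    ⟨isJet_of_contDiff hφ.smooth a b _, by rwa [iteratedDeriv_zero]⟩
  refine hF.hasWeakDeriv hab le_rfl ?_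
  filter_upwards [Lp.coeFn_smul ((-1 : ℂ) ^ n) p.2, h2] with x h3 h4
  rw [h3, Pi.smul_apply, h4, smul_eq_mul, ← mul_assoc, ← mul_pow]
  norm_num

lemma preminimalOp_isClosable (n : ℕ) (hab : a ≤ b) : (preminimalOp n a b).IsClosable := by
  have hd := preminimalOp_dense n hab
  refine (LinearPMap.adjoint_isClosed hd).isClosable.leIsClosable ?_
  refine LinearPMap.IsFormalAdjoint.le_adjoint hd fun u v => ?_
  have hmem : ∀ u : (preminimalOp n a b).domain,
      ((u : L2 a b), preminimalOp n a b u) ∈ preminimalGraph n a b := fun u => by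
    rw [← preminimalOp_graph]
    exact LinearPMap.mem_graph _ u
  exact (hasWeakDeriv_iff_forall_mem_preminimalGraph hab).1
    (mem_preminimalGraph_hasWeakDeriv hab (hmem u)) _ (hmem v)

lemma minimalOp_graph (n : ℕ) (hab : a ≤ b) :
    (minimalOp n a b).graph = (preminimalGraph n a b).topologicalClosure := by
  rw [minimalOp, ← (preminimalOp_isClosable n hab).graph_closure_eq_closure_graph,
    preminimalOp_graph]

lemma minimalOp_dense (n : ℕ) (hab : a ≤ b) :
    Dense ((minimalOp n a b).domain : Set (L2 a b)) :=
  (preminimalOp_dense n hab).mono (LinearPMap.le_closure _).1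

/-- The adjoint of the minimal operator is the maximal operator, in terms of weak derivatives. -/
lemma mem_graph_adjoint_minimalOp_iff (hab : a ≤ b) {f g : L2 a b} :
    (f, g) ∈ (minimalOp n a b).adjoint.graph ↔ HasWeakDeriv (2 * n) f ((-1 : ℂ) ^ n • g) := by
  have hd := minimalOp_dense n hab
  rw [hasWeakDeriv_iff_forall_mem_preminimalGraph hab]
  have hcl : (∀ p ∈ preminimalGraph n a b, inner ℂ g p.1 = inner ℂ f p.2) ↔
      ∀ u : (minimalOp n a b).domain, inner ℂ g (u : L2 a b) = inner ℂ f (minimalOp n a b u) := by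
    constructor
    · intro h u
      have hu : ((u : L2 a b), minimalOp n a b u) ∈ (minimalOp n a b).graph :=
        LinearPMap.mem_graph _ u
      rw [minimalOp_graph n hab] at hu
      have hclosed : IsClosed {p : L2 a b × L2 a b | inner ℂ g p.1 = inner ℂ f p.2} :=
        isClosed_eq (by fun_prop) (by fun_prop)
      exact closure_minimal (s := (preminimalGraph n a b : Set (L2 a b × L2 a b))) h hclosed hu
    · intro h p hp
      have hp' : p ∈ (minimalOp n a b).graph := by
        rw [minimalOp_graph n hab]
        exact Submodule.le_topologicalClosure _ hp
      obtain ⟨u, hu1, hu2⟩ := (LinearPMap.mem_graph_iff _).1 hp'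
      rw [← hu1, ← hu2]
      exact h u
  rw [hcl]
  constructor
  · intro h
    obtain ⟨u, hu1, hu2⟩ := (LinearPMap.mem_graph_iff _).1 h
    change (u : L2 a b) = f at hu1
    change _ = g at hu2
    rw [← hu1, ← hu2]
    exact LinearPMap.adjoint_isFormalAdjoint hd u
  · intro h
    have hf := LinearPMap.mem_adjoint_domain_of_exists f ⟨g, h⟩
    exact (LinearPMap.mem_graph_iff _).2 ⟨⟨f, hf⟩, rfl, LinearPMap.adjoint_apply_eq hd ⟨f, hf⟩ h⟩

lemma minimalOp_le_adjoint (n : ℕ) (hab : a ≤ b) :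
    minimalOp n a b ≤ (minimalOp n a b).adjoint := by
  refine LinearPMap.le_of_le_graph ?_
  rw [minimalOp_graph n hab]
  refine Submodule.topologicalClosure_minimal _ (fun p hp => ?_)
    (LinearPMap.adjoint_isClosed (minimalOp_dense n hab))
  exact (mem_graph_adjoint_minimalOp_iff hab).2 (mem_preminimalGraph_hasWeakDeriv hab hp)

lemma hasWeakDeriv_adjoint_apply (hab : a ≤ b) (f : (minimalOp n a b).adjoint.domain) :
    HasWeakDeriv (2 * n) (f : L2 a b) ((-1 : ℂ) ^ n • (minimalOp n a b).adjoint f) :=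
  (mem_graph_adjoint_minimalOp_iff hab).1 (LinearPMap.mem_graph _ f)

lemma neg_one_pow_smul_smul (n : ℕ) (f : L2 a b) : (-1 : ℂ) ^ n • (-1 : ℂ) ^ n • f = f := by
  rw [smul_smul, ← mul_pow]
  norm_num

lemma adjoint_minimalOp_apply (hab : a ≤ b) (f : (minimalOp n a b).adjoint.domain) :
    (minimalOp n a b).adjoint f = (-1 : ℂ) ^ n • weakDeriv (2 * n) (f : L2 a b) := by
  rw [(hasWeakDeriv_adjoint_apply hab f).weakDeriv_eq, neg_one_pow_smul_smul]

lemma mem_domain_adjoint_minimalOp_iff (hab : a < b) {f : L2 a b} :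
    f ∈ (minimalOp n a b).adjoint.domain ↔ ∃ F, IsJetOf (2 * n) f F := by
  constructor
  · intro hf
    obtain ⟨F, hF, -⟩ := (hasWeakDeriv_adjoint_apply hab.le ⟨f, hf⟩).exists_isJetOf hab
    exact ⟨F, hF⟩
  · rintro ⟨F, hF⟩
    have h := hF.hasWeakDeriv hab.le le_rfl (MemLp.coeFn_toLp (hF.isJet.memLp (2 * n) le_rfl))
    rw [← neg_one_pow_smul_smul n (MemLp.toLp _ _)] at h
    exact LinearPMap.mem_domain_of_mem_graph ((mem_graph_adjoint_minimalOp_iff hab.le).2 h)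

lemma domain_adjoint_minimalOp (n : ℕ) (hab : a < b) :
    ((minimalOp n a b).adjoint.domain : Set (L2 a b)) = sobolev a b (2 * n) := by
  ext f
  rw [mem_sobolev_iff hab, SetLike.mem_coe, mem_domain_adjoint_minimalOp_iff hab]

lemma IsJetOf.adjoint_minimalOp_ae_eq (hab : a ≤ b) {f : (minimalOp n a b).adjoint.domain}
    {F : ℕ → ℝ → ℂ} (hF : IsJetOf (2 * n) (f : L2 a b) F) :
    (minimalOp n a b).adjoint f =ᵐ[volume.restrict (Ioo a b)]
      fun x => (-1 : ℂ) ^ n * F (2 * n) x := by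
  rw [adjoint_minimalOp_apply hab]
  filter_upwards [Lp.coeFn_smul ((-1 : ℂ) ^ n) (weakDeriv (2 * n) (f : L2 a b)),
    hF.weakDeriv_ae_eq hab le_rfl] with x h1 h2
  rw [h1, Pi.smul_apply, h2, smul_eq_mul]

end Adjoint

/-! ### Green's identity and the boundary triplet -/

section Green

variable {n : ℕ} {a b : ℝ}

lemma IsJetOf.inner_Gamma (hab : a < b) {f g : L2 a b} {F G : ℕ → ℝ → ℂ}
    (hF : IsJetOf (2 * n) f F) (hG : IsJetOf (2 * n) g G) :
    inner ℂ (Gamma0 n g) (Gamma1 n f) = (-1 : ℂ) ^ n * ∑ k ∈ Finset.range n, (-1 : ℂ) ^ k *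
      (F (2 * n - 1 - k) b * (starRingEnd ℂ) (G k b)
        - F (2 * n - 1 - k) a * (starRingEnd ℂ) (G k a)) := by
  have ha : a ∈ Icc a b := ⟨le_rfl, hab.le⟩
  have hb : b ∈ Icc a b := ⟨hab.le, le_rfl⟩
  rw [PiLp.inner_apply, Fintype.sum_sum_type, ← Finset.sum_add_distrib, Finset.mul_sum,
    ← Fin.sum_univ_eq_sum_range fun k => (-1 : ℂ) ^ n * ((-1 : ℂ) ^ k *
      (F (2 * n - 1 - k) b * (starRingEnd ℂ) (G k b)
        - F (2 * n - 1 - k) a * (starRingEnd ℂ) (G k a)))]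
  refine Finset.sum_congr rfl fun i _ => ?_
  have hi := i.2
  simp only [Gamma0, Gamma1, Sum.elim_inl, Sum.elim_inr, RCLike.inner_apply]
  rw [hF.derivValue_eq hab (by omega) ha, hF.derivValue_eq hab (by omega) hb,
    hG.derivValue_eq hab (by omega) ha, hG.derivValue_eq hab (by omega) hb]
  have h1 : (-1 : ℂ) ^ n = (-1 : ℂ) ^ (n - (i : ℕ)) * (-1 : ℂ) ^ (i : ℕ) := by
    rw [← pow_add]; congr 1; omega
  have h2 : (-1 : ℂ) ^ (n - (i : ℕ)) = -(-1 : ℂ) ^ (n - 1 - (i : ℕ)) := by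
    have : n - (i : ℕ) = n - 1 - (i : ℕ) + 1 := by omega
    rw [this, pow_succ]
    ring
  have h3 : (-1 : ℂ) ^ (i : ℕ) * (-1 : ℂ) ^ (i : ℕ) = 1 := by rw [← mul_pow]; norm_num
  rw [h1, h2]
  linear_combination (-(-1 : ℂ) ^ (n - 1 - (i : ℕ)) * (F (2 * n - 1 - i) a *
    (starRingEnd ℂ) (G i a) - F (2 * n - 1 - i) b * (starRingEnd ℂ) (G i b))) * h3

/-- The first Green identity: `n` integrations by parts. -/
lemma inner_adjoint_minimalOp (hab : a < b) (f g : (minimalOp n a b).adjoint.domain) :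
    inner ℂ (g : L2 a b) ((minimalOp n a b).adjoint f)
      = inner ℂ (Gamma0 n (g : L2 a b)) (Gamma1 n (f : L2 a b))
        + inner ℂ (weakDeriv n (g : L2 a b)) (weakDeriv n (f : L2 a b)) := by
  obtain ⟨F, hF⟩ := (mem_domain_adjoint_minimalOp_iff hab).1 f.2
  obtain ⟨G, hG⟩ := (mem_domain_adjoint_minimalOp_iff hab).1 g.2
  have hF' : IsJet a b (n + n) F := by rw [← two_mul]; exact hF.isJet
  have h := hF'.shift.integral_mul_eq hab.le (hG.isJet.mono (l := n) (by omega)).conj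
  rw [hF.inner_Gamma hab hG, inner_eq_integral hab.le hG.ae_eq (hF.adjoint_minimalOp_ae_eq hab.le),
    inner_eq_integral hab.le (hG.weakDeriv_ae_eq hab.le (by omega))
      (hF.weakDeriv_ae_eq hab.le (by omega))]
  simp only [mul_assoc, intervalIntegral.integral_const_mul]
  rw [two_mul, h, mul_add, zero_add, ← mul_assoc, ← mul_pow, neg_one_mul, neg_neg, one_pow,
    one_mul]
  congr 2
  refine Finset.sum_congr rfl fun k hk => ?_
  have hk' := Finset.mem_range.1 hk
  have : n - 1 - k + n = n + n - 1 - k := by omega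
  rw [this]

lemma green_identity (hab : a < b) (f g : (minimalOp n a b).adjoint.domain) :
    inner ℂ (g : L2 a b) ((minimalOp n a b).adjoint f)
        - inner ℂ ((minimalOp n a b).adjoint g) (f : L2 a b)
      = inner ℂ (Gamma0 n (g : L2 a b)) (Gamma1 n (f : L2 a b))
        - inner ℂ (Gamma1 n (g : L2 a b)) (Gamma0 n (f : L2 a b)) := by
  rw [← inner_conj_symm ((minimalOp n a b).adjoint g), inner_adjoint_minimalOp hab f g,
    inner_adjoint_minimalOp hab g f, map_add, inner_conj_symm, inner_conj_symm]
  ring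

/-- A smooth cutoff glues a polynomial near `a` to a polynomial near `b`. -/
lemma exists_isJetOf_boundary_values (hab : a < b) (m : ℕ) (da db : ℕ → ℂ) :
    ∃ (f : L2 a b) (F : ℕ → ℝ → ℂ), IsJetOf m f F ∧
      ∀ k < m, F k a = da k ∧ F k b = db k := by
  obtain ⟨p, hp⟩ := exists_polynomial_iterate_derivative_eval m (a : ℂ) da
  obtain ⟨q, hq⟩ := exists_polynomial_iterate_derivative_eval m (b : ℂ) db
  set χ : ℝ → ℝ := fun x => Real.smoothTransition (3 * ((x - a) / (b - a)) - 1) with hχ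
  have hχs : ContDiff ℝ ∞ χ :=
    Real.smoothTransition.contDiff.comp
      ((contDiff_const.mul ((contDiff_id.sub contDiff_const).div_const _)).sub contDiff_const)
  set φ : ℝ → ℂ := fun x => p.eval (x : ℂ) + (χ x : ℂ) * (q.eval (x : ℂ) - p.eval (x : ℂ)) with hφ
  have hφs : ContDiff ℝ ∞ φ :=
    (contDiff_eval_ofReal p).add ((Complex.ofRealCLM.contDiff.comp hχs).mul
      ((contDiff_eval_ofReal q).sub (contDiff_eval_ofReal p)))
  have hpos : 0 < b - a := sub_pos.2 hab
  -- `χ` is `0` on the first third of the interval and `1` on the last third.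
  have ha : φ =ᶠ[nhds a] fun x : ℝ => p.eval (x : ℂ) := by
    filter_upwards [Iio_mem_nhds (show a < a + (b - a) / 3 by linarith)] with x hx
    have hx' : (x - a) / (b - a) ≤ 1 / 3 := by
      rw [div_le_iff₀ hpos]
      linarith [mem_Iio.1 hx]
    have : χ x = 0 := Real.smoothTransition.zero_of_nonpos (by linarith)
    rw [hφ]
    simp only [this, Complex.ofReal_zero, zero_mul, add_zero]
  have hb : φ =ᶠ[nhds b] fun x : ℝ => q.eval (x : ℂ) := by
    filter_upwards [Ioi_mem_nhds (show b - (b - a) / 3 < b by linarith)] with x hx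
    have hx' : 2 / 3 ≤ (x - a) / (b - a) := by
      rw [le_div_iff₀ hpos]
      linarith [mem_Ioi.1 hx]
    have : χ x = 1 := Real.smoothTransition.one_of_one_le (by linarith)
    rw [hφ]
    simp only [this, Complex.ofReal_one, one_mul, add_sub_cancel]
  refine ⟨_, _, (isJet_of_contDiff hφs a b m).isJetOf, fun k hk => ⟨?_, ?_⟩⟩
  · rw [ha.iteratedDeriv_eq, iteratedDeriv_eval_ofReal]
    exact hp k hk
  · rw [hb.iteratedDeriv_eq, iteratedDeriv_eval_ofReal]
    exact hq k hk

lemma Gamma_surjective (hab : a < b) (x y : BdrySpace n) :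
    ∃ f : (minimalOp n a b).adjoint.domain,
      Gamma0 n (f : L2 a b) = x ∧ Gamma1 n (f : L2 a b) = y := by
  -- For `k ≥ n` the derivative of order `k` occurs in `Γ₁` with the index `2n - 1 - k`.
  set da : ℕ → ℂ := fun k => if h : k < n then x (Sum.inl ⟨k, h⟩) else
    if h : 2 * n - 1 - k < n then (-1) ^ (n - 1 - (2 * n - 1 - k)) * y (Sum.inl ⟨_, h⟩) else 0
    with hda
  set db : ℕ → ℂ := fun k => if h : k < n then x (Sum.inr ⟨k, h⟩) else
    if h : 2 * n - 1 - k < n then (-1) ^ (n - (2 * n - 1 - k)) * y (Sum.inr ⟨_, h⟩) else 0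
    with hdb
  obtain ⟨f, F, hF, hFd⟩ := exists_isJetOf_boundary_values hab (2 * n) da db
  have ha : a ∈ Icc a b := ⟨le_rfl, hab.le⟩
  have hb : b ∈ Icc a b := ⟨hab.le, le_rfl⟩
  have hsq : ∀ j : ℕ, (-1 : ℂ) ^ j * (-1 : ℂ) ^ j = 1 := fun j => by rw [← mul_pow]; norm_num
  refine ⟨⟨f, (mem_domain_adjoint_minimalOp_iff hab).2 ⟨F, hF⟩⟩, ?_, ?_⟩
  · ext i
    rcases i with i | i
    · have hi := i.2
      simp only [Gamma0, Sum.elim_inl]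
      rw [hF.derivValue_eq hab (by omega) ha, (hFd i (by omega)).1, hda]
      simp only [hi, dif_pos, Fin.eta]
    · have hi := i.2
      simp only [Gamma0, Sum.elim_inr]
      rw [hF.derivValue_eq hab (by omega) hb, (hFd i (by omega)).2, hdb]
      simp only [hi, dif_pos, Fin.eta]
  · ext i
    rcases i with i | i
    · have hi := i.2
      have h1 : ¬ 2 * n - 1 - (i : ℕ) < n := by omega
      have h2 : 2 * n - 1 - (2 * n - 1 - (i : ℕ)) = i := by omega
      simp only [Gamma1, Sum.elim_inl]
      rw [hF.derivValue_eq hab (by omega) ha, (hFd _ (by omega)).1, hda]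
      simp only [h1, h2, hi, dif_pos, dif_neg, not_false_eq_true, Fin.eta]
      rw [← mul_assoc, hsq, one_mul]
    · have hi := i.2
      have h1 : ¬ 2 * n - 1 - (i : ℕ) < n := by omega
      have h2 : 2 * n - 1 - (2 * n - 1 - (i : ℕ)) = i := by omega
      simp only [Gamma1, Sum.elim_inr]
      rw [hF.derivValue_eq hab (by omega) hb, (hFd _ (by omega)).2, hdb]
      simp only [h1, h2, hi, dif_pos, dif_neg, not_false_eq_true, Fin.eta]
      rw [← mul_assoc, hsq, one_mul]

lemma isLinearMap_derivValue (hab : a < b) {k : ℕ} (hk : k < 2 * n) {x : ℝ} (hx : x ∈ Icc a b) :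
    IsLinearMap ℂ fun f : (minimalOp n a b).adjoint.domain => derivValue (f : L2 a b) k x := by
  refine ⟨fun f g => ?_, fun c f => ?_⟩
  · obtain ⟨F, hF⟩ := (mem_domain_adjoint_minimalOp_iff hab).1 f.2
    obtain ⟨G, hG⟩ := (mem_domain_adjoint_minimalOp_iff hab).1 g.2
    rw [hF.derivValue_eq hab hk hx, hG.derivValue_eq hab hk hx,
      ← (hF.add hab.le hG).derivValue_eq hab hk hx]
    rfl
  · obtain ⟨F, hF⟩ := (mem_domain_adjoint_minimalOp_iff hab).1 f.2
    rw [hF.derivValue_eq hab hk hx, smul_eq_mul, ← (hF.const_smul c).derivValue_eq hab hk hx]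
    rfl

lemma isBoundaryTriplet_Gamma (hab : a < b) :
    IsBoundaryTriplet (minimalOp n a b) (fun f => Gamma0 n (f : L2 a b))
      (fun f => Gamma1 n (f : L2 a b)) := by
  have ha : a ∈ Icc a b := ⟨le_rfl, hab.le⟩
  have hb : b ∈ Icc a b := ⟨hab.le, le_rfl⟩
  refine ⟨⟨fun f g => ?_, fun c f => ?_⟩, ⟨fun f g => ?_, fun c f => ?_⟩, green_identity hab,
    fun xy => ?_⟩
  · ext (i | i) <;> simp only [Gamma0, PiLp.add_apply, Sum.elim_inl, Sum.elim_inr]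
    · exact (isLinearMap_derivValue hab (by omega) ha).map_add f g
    · exact (isLinearMap_derivValue hab (by omega) hb).map_add f g
  · ext (i | i) <;> simp only [Gamma0, PiLp.smul_apply, Sum.elim_inl, Sum.elim_inr]
    · exact (isLinearMap_derivValue hab (by omega) ha).map_smul c f
    · exact (isLinearMap_derivValue hab (by omega) hb).map_smul c f
  · ext (i | i) <;> simp only [Gamma1, PiLp.add_apply, Sum.elim_inl, Sum.elim_inr]
    · rw [← mul_add]
      exact congrArg _ ((isLinearMap_derivValue hab (by omega) ha).map_add f g)
    · rw [← mul_add]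
      exact congrArg _ ((isLinearMap_derivValue hab (by omega) hb).map_add f g)
  · ext (i | i) <;> simp only [Gamma1, PiLp.smul_apply, Sum.elim_inl, Sum.elim_inr]
    · rw [← mul_smul_comm]
      exact congrArg _ ((isLinearMap_derivValue hab (by omega) ha).map_smul c f)
    · rw [← mul_smul_comm]
      exact congrArg _ ((isLinearMap_derivValue hab (by omega) hb).map_smul c f)
  · obtain ⟨f, h0, h1⟩ := Gamma_surjective hab xy.1 xy.2
    exact ⟨f, Prod.ext h0 h1⟩

lemma IsMinimalVector.Gamma1_eq_zero (hab : a < b) {w : (minimalOp n a b).adjoint.domain}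
    (hw : IsMinimalVector (minimalOp n a b) w) : Gamma1 n (w : L2 a b) = 0 := by
  obtain ⟨g, hg0, hg1⟩ := Gamma_surjective hab (Gamma1 n (w : L2 a b)) 0
  have h := green_identity hab w g
  rw [hw g, sub_self, hg0, hg1, inner_zero_left, sub_zero] at h
  exact inner_self_eq_zero.1 h.symm

lemma IsMinimalVector.re_inner_nonneg (hab : a < b) {w : (minimalOp n a b).adjoint.domain}
    (hw : IsMinimalVector (minimalOp n a b) w) :
    0 ≤ (inner ℂ (w : L2 a b) ((minimalOp n a b).adjoint w)).re := by
  rw [inner_adjoint_minimalOp hab w w, hw.Gamma1_eq_zero hab, inner_zero_right, zero_add]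
  exact inner_self_nonneg (𝕜 := ℂ)

lemma isMinimalVector_of_forall_eq_zero (hab : a < b) {w : (minimalOp n a b).adjoint.domain}
    {W : ℕ → ℝ → ℂ} (hW : IsJetOf (2 * n) (w : L2 a b) W)
    (h : ∀ k < 2 * n, W k a = 0 ∧ W k b = 0) : IsMinimalVector (minimalOp n a b) w := by
  have ha : a ∈ Icc a b := ⟨le_rfl, hab.le⟩
  have hb : b ∈ Icc a b := ⟨hab.le, le_rfl⟩
  have hz : ∀ k < 2 * n, derivValue (w : L2 a b) k a = 0 ∧ derivValue (w : L2 a b) k b = 0 :=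
    fun k hk => ⟨(hW.derivValue_eq hab hk ha).trans (h k hk).1,
      (hW.derivValue_eq hab hk hb).trans (h k hk).2⟩
  have h0 : Gamma0 n (w : L2 a b) = 0 := by
    ext (i | i)
    · exact (hz i (by omega)).1
    · exact (hz i (by omega)).2
  have h1 : Gamma1 n (w : L2 a b) = 0 := by
    ext (i | i)
    · simp only [Gamma1, Sum.elim_inl, (hz (2 * n - 1 - i) (by omega)).1, mul_zero, PiLp.zero_apply]
    · simp only [Gamma1, Sum.elim_inr, (hz (2 * n - 1 - i) (by omega)).2, mul_zero, PiLp.zero_apply]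
  intro g
  have := green_identity hab w g
  rwa [h0, h1, inner_zero_right, inner_zero_right, sub_zero, sub_eq_zero] at this

end Green

/-! ### The domain of the soft extension -/

section Soft

variable {n : ℕ} {a b : ℝ}

lemma IsJetOf.adjoint_eq_zero (hab : a ≤ b) {p : (minimalOp n a b).adjoint.domain}
    {P : ℕ → ℝ → ℂ} (hP : IsJetOf (2 * n) (p : L2 a b) P) (h : P (2 * n) = 0) :
    (minimalOp n a b).adjoint p = 0 := by
  rw [Lp.eq_zero_iff_ae_eq_zero]
  filter_upwards [hP.adjoint_minimalOp_ae_eq hab] with x hx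
  rw [hx, h, Pi.zero_apply, mul_zero]

/-- The decomposition behind the soft extension: `f` minus its Taylor polynomial at `a`. -/
lemma exists_minimal_add_kernel (hab : a < b) {f : L2 a b} {F P : ℕ → ℝ → ℂ}
    (hF : IsJetOf (2 * n) f F) (hP : IsJet a b (2 * n) P) (hP0 : P (2 * n) = 0)
    (hPa : ∀ k < 2 * n, P k a = F k a) (hPb : ∀ k < 2 * n, P k b = F k b) :
    ∃ w p : (minimalOp n a b).adjoint.domain, IsMinimalVector (minimalOp n a b) w ∧
      (minimalOp n a b).adjoint p = 0 ∧ f = w + p := by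
  have hp := hP.isJetOf
  have hw := hF.sub hab.le hp
  refine ⟨⟨_, (mem_domain_adjoint_minimalOp_iff hab).2 ⟨_, hw⟩⟩,
    ⟨_, (mem_domain_adjoint_minimalOp_iff hab).2 ⟨_, hp⟩⟩,
    isMinimalVector_of_forall_eq_zero hab hw fun k hk => ?_, IsJetOf.adjoint_eq_zero hab.le hp hP0,
    (sub_add_cancel _ _).symm⟩
  rw [hPa k hk, hPb k hk, sub_self, sub_self]
  exact ⟨rfl, rfl⟩

lemma mem_softDomain_of_decomposition {H : Type*} [NormedAddCommGroup H] [InnerProductSpace ℂ H]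
    [CompleteSpace H] {A : H →ₗ.[ℂ] H} {f : H} {w p : A.adjoint.domain}
    (hw : IsMinimalVector A w) (hp : A.adjoint p = 0) (hf : f = w + p) : f ∈ softDomain A := by
  subst hf
  refine ⟨add_mem w.2 p.2, fun q hq => ?_⟩
  have : A.adjoint ⟨(w : H) + p, add_mem w.2 p.2⟩ = A.adjoint w + A.adjoint p :=
    A.adjoint.map_add w p
  rw [this, hp, add_zero, hw q, hq, inner_zero_left]

/-- A chain which vanishes at `a` and whose last function is orthogonal to the
polynomials of degree less than `m` vanishes at `b`: test with the polynomials `(x - b)^k`. -/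
lemma IsJet.eq_zero_of_orthogonal (hab : a < b) {m : ℕ} {W : ℕ → ℝ → ℂ} (hW : IsJet a b m W)
    (hWa : ∀ k < m, W k a = 0)
    (h : ∀ Q, IsJet a b m Q → Q m = 0 → ∫ x in a..b, W m x * (starRingEnd ℂ) (Q 0 x) = 0)
    {k : ℕ} (hk : k < m) : W k b = 0 := by
  -- Of all boundary terms at `b` this choice of `Q` leaves the one with `W k`.
  obtain ⟨Q, hQ, hQm, hQb⟩ := exists_isJet hab.le (right_mem_Icc.2 hab.le) m
    (fun j => if j = m - 1 - k then 1 else 0) (MemLp.zero' (ε := ℂ))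
  have h1 := hW.integral_mul_eq hab.le hQ.conj
  rw [h Q hQ hQm, Finset.sum_eq_single (m - 1 - k)] at h1
  · have hkk : m - 1 - (m - 1 - k) = k := by omega
    rw [hkk, hWa k hk, hQb _ (by omega), hQm] at h1
    simp only [if_true, map_one, map_zero, mul_one, zero_mul, sub_zero, mul_zero,
      intervalIntegral.integral_zero, add_zero] at h1
    exact (mul_eq_zero.1 h1.symm).resolve_left (pow_ne_zero _ (neg_ne_zero.2 one_ne_zero))
  · intro j hj hne
    have hj' := Finset.mem_range.1 hj
    rw [hWa _ (by omega), hQb j hj', if_neg hne, map_zero]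
    ring
  · intro hn
    exact absurd (Finset.mem_range.2 (by omega)) hn

/-- `f` is in the domain of the soft extension if and only if its derivatives at `b` are those of
its Taylor polynomial at `a` of degree less than `2n`. -/
lemma IsJetOf.mem_softDomain_iff (hab : a < b) {f : L2 a b} {F P : ℕ → ℝ → ℂ}
    (hF : IsJetOf (2 * n) f F) (hP : IsJet a b (2 * n) P) (hP0 : P (2 * n) = 0)
    (hPa : ∀ k < 2 * n, P k a = F k a) :
    f ∈ softDomain (minimalOp n a b) ↔ ∀ k < 2 * n, P k b = F k b := by
  constructor
  · rintro ⟨hf, h⟩ k hk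
    refine (sub_eq_zero.1 ((hF.isJet.sub hab.le hP).eq_zero_of_orthogonal hab
      (fun j hj => sub_eq_zero.2 (hPa j hj).symm) (fun Q hQ hQ0 => ?_) hk)).symm
    have hq := hQ.isJetOf
    have h1 := h ⟨_, (mem_domain_adjoint_minimalOp_iff hab).2 ⟨_, hq⟩⟩
      (IsJetOf.adjoint_eq_zero hab.le hq hQ0)
    rw [inner_eq_integral hab.le hq.ae_eq
      (IsJetOf.adjoint_minimalOp_ae_eq (f := ⟨f, hf⟩) hab.le hF)] at h1
    simp only [mul_assoc, intervalIntegral.integral_const_mul] at h1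
    have h2 := (mul_eq_zero.1 h1).resolve_left (pow_ne_zero _ (neg_ne_zero.2 one_ne_zero))
    simpa only [hP0, Pi.zero_apply, sub_zero] using h2
  · intro hPb
    obtain ⟨w, p, hw, hp, hf⟩ := exists_minimal_add_kernel hab hF hP hP0 hPa hPb
    exact mem_softDomain_of_decomposition hw hp hf

lemma exists_isJet_taylor (hab : a ≤ b) (m : ℕ) (d : ℕ → ℂ) :
    ∃ P, IsJet a b m P ∧ P m = 0 ∧ ∀ k < m, P k a = d k :=
  exists_isJet hab (left_mem_Icc.2 hab) m d (MemLp.zero' (ε := ℂ))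

theorem isKreinExtension_minimalOp (hab : a < b) :
    IsKreinExtension (minimalOp n a b) (softExtension (minimalOp n a b)) := by
  refine isKreinExtension_softExtension (minimalOp_dense n hab.le) (minimalOp_le_adjoint n hab.le)
    (fun w hw => hw.re_inner_nonneg hab) fun f => ?_
  obtain ⟨F, hF⟩ := (mem_domain_adjoint_minimalOp_iff hab).1 f.2.1
  obtain ⟨P, hP, hP0, hPa⟩ := exists_isJet_taylor hab.le (2 * n) fun k => F k a
  exact exists_minimal_add_kernel hab hF hP hP0 hPa
    ((hF.mem_softDomain_iff hab hP hP0 hPa).1 f.2)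

end Soft

/-! ### Taylor's formula and the matrices `T`, `T₁`, `T₂` -/

section Matrices

variable {n : ℕ} {a b : ℝ}

lemma IsJet.taylor (hab : a ≤ b) {m : ℕ} {P : ℕ → ℝ → ℂ} (hP : IsJet a b m P) (hP0 : P m = 0)
    {x : ℝ} (hx : x ∈ Icc a b) :
    P 0 x = ∑ j ∈ Finset.range m, ((x - a : ℝ) : ℂ) ^ j / (j.factorial : ℂ) * P j a := by
  induction m generalizing P x with
  | zero => simp [hP0]
  | succ m ih =>
    have ha : a ∈ Icc a b := ⟨le_rfl, hab⟩
    have hder : ∀ t : ℝ, HasDerivAt (fun t : ℝ => ∑ j ∈ Finset.range m,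
        ((t - a : ℝ) : ℂ) ^ (j + 1) / ((j + 1).factorial : ℂ) * P (j + 1) a)
        (∑ j ∈ Finset.range m, ((t - a : ℝ) : ℂ) ^ j / (j.factorial : ℂ) * P (j + 1) a) t := by
      intro t
      refine HasDerivAt.fun_sum fun j _ => ?_
      have h1 : HasDerivAt (fun t : ℝ => ((t - a : ℝ) : ℂ)) 1 t := by
        simpa using ((hasDerivAt_id t).sub_const a).ofReal_comp
      have h2 := ((h1.fun_pow (j + 1)).div_const ((j + 1).factorial : ℂ)).mul_const (P (j + 1) a)
      refine h2.congr_deriv ?_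
      have h3 : (j.factorial : ℂ) ≠ 0 := Nat.cast_ne_zero.2 j.factorial_ne_zero
      have h4 : ((j : ℂ) + 1) ≠ 0 := by exact_mod_cast j.succ_ne_zero
      rw [Nat.factorial_succ]
      rw [Nat.add_sub_cancel]
      push_cast
      field_simp
    have h := hP.sub_eq 0 m.succ_pos a ha x hx
    rw [intervalIntegral.integral_congr (g := fun t : ℝ => ∑ j ∈ Finset.range m,
        ((t - a : ℝ) : ℂ) ^ j / (j.factorial : ℂ) * P (j + 1) a) (fun t ht => by
          rw [uIcc_of_le hx.1] at ht
          exact ih hP.shift hP0 ⟨ht.1, ht.2.trans hx.2⟩),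
      intervalIntegral.integral_eq_sub_of_hasDerivAt (fun t _ => hder t)
        (by apply Continuous.intervalIntegrable; fun_prop)] at h
    rw [Finset.sum_range_succ', eq_add_of_sub_eq h]
    simp

lemma IsJet.taylor_apply (hab : a ≤ b) {m : ℕ} {P : ℕ → ℝ → ℂ} (hP : IsJet a b m P)
    (hP0 : P m = 0) {k : ℕ} (hk : k ≤ m) :
    P k b = ∑ j ∈ Finset.range (m - k), ((b - a : ℝ) : ℂ) ^ j / (j.factorial : ℂ) * P (k + j) a := by
  have hm : m - k + k = m := Nat.sub_add_cancel hk
  have hs : IsJet a b (m - k) fun j => P (j + k) := IsJet.shift (by rwa [hm])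
  have h := hs.taylor hab (by simp only [hm, hP0]) (right_mem_Icc.2 hab)
  simp only [zero_add] at h
  simpa only [add_comm k] using h

/-- Coordinates of a lower triangular Toeplitz matrix applied to a vector listed in descending
order. -/
lemma matT_mulVec (m : ℕ) (ℓ : ℝ) (v : ℕ → ℂ) (i : Fin m) :
    (matT m ℓ).mulVec (fun j : Fin m => v (m - 1 - j)) i
      = ∑ r ∈ Finset.range (i + 1), (ℓ : ℂ) ^ r / (r.factorial : ℂ) * v (m - 1 - i + r) := by
  have hi := i.2
  simp only [Matrix.mulVec, dotProduct, matT, Matrix.of_apply, Fin.le_def]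
  rw [Fin.sum_univ_eq_sum_range (fun j => (if j ≤ (i : ℕ) then
    (ℓ : ℂ) ^ ((i : ℕ) - j) / (((i : ℕ) - j).factorial : ℂ) else 0) * v (m - 1 - j)),
    ← Finset.sum_subset (s₁ := Finset.range (i + 1)), ← Finset.sum_range_reflect]
  · refine Finset.sum_congr rfl fun r hr => ?_
    have hr' := Finset.mem_range.1 hr
    have h1 : (i : ℕ) + 1 - 1 - r ≤ i := by omega
    have h2 : (i : ℕ) - ((i : ℕ) + 1 - 1 - r) = r := by omega
    have h3 : m - 1 - ((i : ℕ) + 1 - 1 - r) = m - 1 - i + r := by omega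
    rw [if_pos h1, h2, h3]
  · intro r hr
    have := Finset.mem_range.1 hr
    exact Finset.mem_range.2 (by omega)
  · intro r _ hr
    have : ¬ r ≤ (i : ℕ) := fun h => hr (Finset.mem_range.2 (by omega))
    rw [if_neg this, zero_mul]

lemma matT2_mulVec (n : ℕ) (ℓ : ℝ) (v : ℕ → ℂ) (i : Fin n) :
    (matT2 n ℓ).mulVec (fun j : Fin n => v (2 * n - 1 - j)) i
      = ∑ s ∈ Finset.range n, (ℓ : ℂ) ^ (i + 1 + s) / ((i + 1 + s : ℕ).factorial : ℂ) *
          v (n + s) := by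
  have hi := i.2
  simp only [Matrix.mulVec, dotProduct, matT2, Matrix.of_apply]
  rw [Fin.sum_univ_eq_sum_range (fun j => (ℓ : ℂ) ^ (n + (i : ℕ) - j) /
    ((n + (i : ℕ) - j).factorial : ℂ) * v (2 * n - 1 - j)), ← Finset.sum_range_reflect]
  refine Finset.sum_congr rfl fun r hr => ?_
  have hr' := Finset.mem_range.1 hr
  have h2 : n + (i : ℕ) - (n - 1 - r) = i + 1 + r := by omega
  have h3 : 2 * n - 1 - (n - 1 - r) = n + r := by omega
  rw [h2, h3]

lemma matS_mulVec (v : ℕ → ℂ) :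
    (matS n).mulVec (fun j : Fin n => v j) = fun i : Fin n => v (n - 1 - i) := by
  funext i
  have hi := i.2
  simp only [Matrix.mulVec, dotProduct, matS, Matrix.of_apply, ite_mul, one_mul, zero_mul]
  rw [Finset.sum_eq_single (⟨n - 1 - i, by omega⟩ : Fin n)]
  · rw [if_pos (show (i : ℕ) + (n - 1 - i) + 1 = n by omega)]
  · intro j _ hj
    rw [if_neg]
    intro h
    exact hj (Fin.ext (show (j : ℕ) = n - 1 - i by omega))
  · intro h
    exact absurd (Finset.mem_univ _) h

/-- The condition that `v` (the derivatives at `b`) is obtained from `u` (the derivatives at `a`)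
by Taylor's formula, split into the blocks of derivatives of order at least `n` and less than
`n`. -/
lemma forall_taylor_iff (n : ℕ) (ℓ : ℝ) (u v : ℕ → ℂ) :
    (∀ k < 2 * n, v k = ∑ j ∈ Finset.range (2 * n - k),
        (ℓ : ℂ) ^ j / (j.factorial : ℂ) * u (k + j)) ↔
      (fun i : Fin n => v (2 * n - 1 - i))
          = (matT n ℓ).mulVec (fun i : Fin n => u (2 * n - 1 - i)) ∧
        (fun i : Fin n => v (n - 1 - i))
          = (matT2 n ℓ).mulVec (fun i : Fin n => u (2 * n - 1 - i))
            + (matT n ℓ).mulVec (fun i : Fin n => u (n - 1 - i)) := by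
  have hT1 : ∀ i : Fin n, (matT n ℓ).mulVec (fun i : Fin n => u (2 * n - 1 - i)) i
      = ∑ j ∈ Finset.range (2 * n - (2 * n - 1 - i)),
        (ℓ : ℂ) ^ j / (j.factorial : ℂ) * u (2 * n - 1 - i + j) := by
    intro i
    have hi := i.2
    have h1 : (fun i : Fin n => u (2 * n - 1 - i)) = fun i : Fin n => u (n + (n - 1 - i)) := by
      funext j
      have hj := j.2
      congr 1
      omega
    rw [h1, matT_mulVec n ℓ (fun k => u (n + k))]
    have h2 : 2 * n - (2 * n - 1 - (i : ℕ)) = i + 1 := by omega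
    have h3 : 2 * n - 1 - (i : ℕ) = n + (n - 1 - i) := by omega
    rw [h2, h3]
    exact Finset.sum_congr rfl fun r _ => by rw [add_assoc]
  have hT2 : ∀ i : Fin n, ((matT2 n ℓ).mulVec (fun i : Fin n => u (2 * n - 1 - i))
      + (matT n ℓ).mulVec (fun i : Fin n => u (n - 1 - i))) i
      = ∑ j ∈ Finset.range (2 * n - (n - 1 - i)),
        (ℓ : ℂ) ^ j / (j.factorial : ℂ) * u (n - 1 - i + j) := by
    intro i
    have hi := i.2
    have h2 : 2 * n - (n - 1 - (i : ℕ)) = (i + 1) + n := by omega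
    have h3 : ∀ s, n - 1 - (i : ℕ) + (i + 1 + s) = n + s := fun s => by omega
    rw [Pi.add_apply, matT_mulVec, matT2_mulVec, h2, Finset.sum_range_add _ ((i : ℕ) + 1) n,
      add_comm]
    simp only [h3]
  constructor
  · intro h
    constructor
    · funext i
      have hi := i.2
      rw [hT1, ← h _ (by omega)]
    · funext i
      have hi := i.2
      rw [hT2, ← h _ (by omega)]
  · rintro ⟨h1, h2⟩ k hk
    rcases lt_or_ge k n with hkn | hkn
    · have h := congrFun h2 ⟨n - 1 - k, by omega⟩
      rw [hT2] at h
      have h3 : n - 1 - (n - 1 - k) = k := by omega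
      simpa only [h3] using h
    · have h := congrFun h1 ⟨2 * n - 1 - k, by omega⟩
      rw [hT1] at h
      have h3 : 2 * n - 1 - (2 * n - 1 - k) = k := by omega
      simpa only [h3] using h

/-- If `T₂ u = 0`, the polynomial of degree less than `2n` with derivatives `0, …, 0` and `u` at `a`
vanishes to the order `n` at both end points, so that by the first Green identity its derivative of
order `n` vanishes. -/
lemma isUnit_det_matT2 (n : ℕ) (hab : a < b) : IsUnit (matT2 n (b - a)).det := by
  rw [← Matrix.isUnit_iff_isUnit_det, ← Matrix.mulVec_injective_iff_isUnit]
  have hinj : ∀ u : Fin n → ℂ, (matT2 n (b - a)).mulVec u = 0 → u = 0 := by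
    intro u hu
    obtain ⟨P, hP, hP0, hPa⟩ := exists_isJet_taylor hab.le (2 * n) fun k =>
      if h : 2 * n - 1 - k < n then u ⟨2 * n - 1 - k, h⟩ else 0
    have ha : a ∈ Icc a b := ⟨le_rfl, hab.le⟩
    have hb : b ∈ Icc a b := ⟨hab.le, le_rfl⟩
    have hlow : ∀ k < n, P k a = 0 := fun k hk => by
      rw [hPa k (by omega), dif_neg (by omega)]
    have hup : (fun i : Fin n => P (2 * n - 1 - i) a) = u := by
      funext i
      have hi := i.2
      have h2 : 2 * n - 1 - (2 * n - 1 - (i : ℕ)) = i := by omega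
      rw [hPa _ (by omega)]
      simp only [h2, hi, dif_pos, Fin.eta]
    have htaylor := ((forall_taylor_iff n (b - a) (fun k => P k a) fun k => P k b).1
      fun k hk => hP.taylor_apply hab.le hP0 hk.le).2
    have hlow' : (fun i : Fin n => P (n - 1 - i) a) = 0 := by
      funext i
      have hi := i.2
      exact hlow _ (by omega)
    rw [hup, hu, hlow', Matrix.mulVec_zero, add_zero] at htaylor
    have hlowb : ∀ k < n, P k b = 0 := fun k hk => by
      have h : P (n - 1 - (n - 1 - k)) b = 0 := congrFun htaylor ⟨n - 1 - k, by omega⟩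
      have h3 : n - 1 - (n - 1 - k) = k := by omega
      rwa [h3] at h
    have hp := hP.isJetOf
    set p : (minimalOp n a b).adjoint.domain :=
      ⟨_, (mem_domain_adjoint_minimalOp_iff hab).2 ⟨_, hp⟩⟩ with hpdef
    have hpj : IsJetOf (2 * n) (p : L2 a b) P := hp
    have hG0 : Gamma0 n (p : L2 a b) = 0 := by
      ext (i | i)
      · exact (hpj.derivValue_eq hab (by omega) ha).trans (hlow i i.2)
      · exact (hpj.derivValue_eq hab (by omega) hb).trans (hlowb i i.2)
    have hgreen := inner_adjoint_minimalOp hab p p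
    rw [IsJetOf.adjoint_eq_zero hab.le hpj hP0, inner_zero_right, hG0, inner_zero_left,
      zero_add] at hgreen
    have hzero : weakDeriv n (p : L2 a b) = 0 := inner_self_eq_zero.1 hgreen.symm
    have hshift : IsJetOf n (0 : L2 a b) fun k => P (k + n) := by
      refine ⟨IsJet.shift (by rw [← two_mul]; exact hP), ?_⟩
      rw [← hzero, zero_add]
      exact hpj.weakDeriv_ae_eq hab.le (by omega)
    have htriv : IsJetOf n (0 : L2 a b) fun _ _ => 0 := by
      have h := hshift.const_smul 0
      simpa only [smul_zero, zero_mul] using h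
    have hall : ∀ k < n, P (k + n) a = 0 := fun k hk => by
      rw [← hshift.derivValue_eq hab hk ha, htriv.derivValue_eq hab hk ha]
    rw [← hup]
    funext i
    have hi := i.2
    have h3 : 2 * n - 1 - (i : ℕ) = n - 1 - i + n := by omega
    rw [h3, hall _ (by omega), Pi.zero_apply]
  intro u v huv
  rw [← sub_eq_zero]
  apply hinj
  rw [Matrix.mulVec_sub, huv, sub_self]

/-! ### The boundary conditions of the Krein extension -/

lemma descJet_eq_iff (hab : a < b) {f : L2 a b} {F : ℕ → ℝ → ℂ} (hF : IsJetOf (2 * n) f F) :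
    descJet (2 * n) f b = (matT (2 * n) (b - a)).mulVec (descJet (2 * n) f a) ↔
      ∀ k < 2 * n, F k b = ∑ j ∈ Finset.range (2 * n - k),
        ((b - a : ℝ) : ℂ) ^ j / (j.factorial : ℂ) * F (k + j) a := by
  have hd : ∀ x ∈ Icc a b, descJet (2 * n) f x = fun i : Fin (2 * n) => F (2 * n - 1 - i) x :=
    fun x hx => funext fun i => hF.derivValue_eq hab (by omega) hx
  rw [hd a ⟨le_rfl, hab.le⟩, hd b ⟨hab.le, le_rfl⟩]
  constructor
  · intro h k hk
    have h1 := congrFun h ⟨2 * n - 1 - k, by omega⟩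
    rw [matT_mulVec (2 * n) (b - a) fun k => F k a] at h1
    have h2 : 2 * n - 1 - (2 * n - 1 - k) = k := by omega
    have h3 : 2 * n - 1 - k + 1 = 2 * n - k := by omega
    simpa only [h2, h3] using h1
  · intro h
    funext i
    have hi := i.2
    rw [matT_mulVec (2 * n) (b - a) fun k => F k a, h _ (by omega)]
    have h3 : 2 * n - (2 * n - 1 - (i : ℕ)) = i + 1 := by omega
    rw [h3]

lemma mem_softDomain_minimalOp_iff (hab : a < b) {f : L2 a b} {F : ℕ → ℝ → ℂ}
    (hF : IsJetOf (2 * n) f F) :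
    f ∈ softDomain (minimalOp n a b) ↔ ∀ k < 2 * n, F k b = ∑ j ∈ Finset.range (2 * n - k),
        ((b - a : ℝ) : ℂ) ^ j / (j.factorial : ℂ) * F (k + j) a := by
  obtain ⟨P, hP, hP0, hPa⟩ := exists_isJet_taylor hab.le (2 * n) fun k => F k a
  rw [hF.mem_softDomain_iff hab hP hP0 hPa]
  refine forall₂_congr fun k hk => ?_
  rw [hP.taylor_apply hab.le hP0 hk.le, eq_comm]
  have : ∀ j ∈ Finset.range (2 * n - k), ((b - a : ℝ) : ℂ) ^ j / (j.factorial : ℂ) * P (k + j) a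
      = ((b - a : ℝ) : ℂ) ^ j / (j.factorial : ℂ) * F (k + j) a := fun j hj => by
    have := Finset.mem_range.1 hj
    rw [hPa _ (by omega)]
  rw [Finset.sum_congr rfl this]

/-- Solving the two blocks of the boundary condition for the derivatives of order at least `n`. -/
lemma mulVec_matBK_eq_iff {ℓ : ℝ} (hT : IsUnit (matT2 n ℓ).det) (ua ub la lb : Fin n → ℂ) :
    Sum.elim (-(matQ n).mulVec ua) ((matQ n).mulVec ub)
        = (matBK n ℓ).mulVec (Sum.elim la lb) ↔
      ub = (matT n ℓ).mulVec ua ∧ (matS n).mulVec lb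
        = (matT2 n ℓ).mulVec ua + (matT n ℓ).mulVec ((matS n).mulVec la) := by
  have hQ : matQ n * matQ n = 1 := by
    rw [matQ, Matrix.diagonal_mul_diagonal, ← Matrix.diagonal_one]
    congr 1
    funext i
    rw [← mul_pow]
    norm_num
  have hQinj : ∀ u v : Fin n → ℂ, (matQ n).mulVec u = (matQ n).mulVec v ↔ u = v := by
    intro u v
    constructor
    · intro h
      have h1 := congrArg (matQ n).mulVec h
      rwa [Matrix.mulVec_mulVec, Matrix.mulVec_mulVec, hQ, Matrix.one_mulVec,
        Matrix.one_mulVec] at h1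
    · rintro rfl
      rfl
  -- `z` is the solution of the lower block for the derivatives of order at least `n` at `a`.
  set z := (matT2 n ℓ)⁻¹.mulVec
    ((matS n).mulVec lb - (matT n ℓ).mulVec ((matS n).mulVec la)) with hz
  have hB : (matBK n ℓ).mulVec (Sum.elim la lb)
      = Sum.elim (-(matQ n).mulVec z) ((matQ n).mulVec ((matT n ℓ).mulVec z)) := by
    rw [matBK, Matrix.fromBlocks_mulVec, hz]
    simp only [Sum.elim_comp_inl, Sum.elim_comp_inr, Matrix.neg_mulVec, ← Matrix.mulVec_mulVec,
      Matrix.mulVec_sub]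
    congr 1 <;> abel
  have hzu : ua = z ↔ (matS n).mulVec lb
      = (matT2 n ℓ).mulVec ua + (matT n ℓ).mulVec ((matS n).mulVec la) := by
    rw [hz]
    constructor
    · intro h
      rw [h, Matrix.mulVec_mulVec, Matrix.mul_nonsing_inv _ hT, Matrix.one_mulVec, sub_add_cancel]
    · intro h
      rw [h, add_sub_cancel_right, Matrix.mulVec_mulVec, Matrix.nonsing_inv_mul _ hT,
        Matrix.one_mulVec]
  rw [hB, Sum.elim_eq_iff, neg_inj, hQinj, hQinj, ← hzu]
  constructor
  · rintro ⟨h1, h2⟩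
    exact ⟨h1 ▸ h2, h1⟩
  · rintro ⟨h1, h2⟩
    exact ⟨h2, h2 ▸ h1⟩

lemma Gamma1_eq_iff (hab : a < b) {f : L2 a b} {F : ℕ → ℝ → ℂ} (hF : IsJetOf (2 * n) f F) :
    (Gamma1 n f).ofLp = (matBK n (b - a)).mulVec (Gamma0 n f).ofLp ↔
      ∀ k < 2 * n, F k b = ∑ j ∈ Finset.range (2 * n - k),
        ((b - a : ℝ) : ℂ) ^ j / (j.factorial : ℂ) * F (k + j) a := by
  have ha : a ∈ Icc a b := ⟨le_rfl, hab.le⟩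
  have hb : b ∈ Icc a b := ⟨hab.le, le_rfl⟩
  have h0 : (Gamma0 n f).ofLp = Sum.elim (fun i : Fin n => F i a) fun i : Fin n => F i b := by
    funext i
    rcases i with i | i
    · exact hF.derivValue_eq hab (by omega) ha
    · exact hF.derivValue_eq hab (by omega) hb
  have h1 : (Gamma1 n f).ofLp = Sum.elim (-(matQ n).mulVec fun i : Fin n => F (2 * n - 1 - i) a)
      ((matQ n).mulVec fun i : Fin n => F (2 * n - 1 - i) b) := by
    funext i
    rcases i with i | i <;> have hi := i.2 <;>
      simp only [Gamma1, Sum.elim_inl, Sum.elim_inr]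
    · have h2 : n - (i : ℕ) = n - 1 - i + 1 := by omega
      rw [hF.derivValue_eq hab (by omega) ha, Pi.neg_apply, matQ, Matrix.mulVec_diagonal, h2,
        pow_succ]
      ring
    · rw [hF.derivValue_eq hab (by omega) hb, matQ, Matrix.mulVec_diagonal]
  rw [h0, h1, mulVec_matBK_eq_iff (isUnit_det_matT2 n hab), matS_mulVec fun k => F k a,
    matS_mulVec fun k => F k b,
    forall_taylor_iff n (b - a) (fun k => F k a) fun k => F k b]

end Matrices

end KreinExt

theorem mainTheorem1 (n : ℕ) (hn : 1 ≤ n) (a b : ℝ) (hab : a < b) :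
    ((KreinExt.minimalOp n a b).adjoint.domain : Set (KreinExt.L2 a b))
        = KreinExt.sobolev a b (2 * n) ∧
    (∀ f : (KreinExt.minimalOp n a b).adjoint.domain,
      (KreinExt.minimalOp n a b).adjoint f
        = (-1 : ℂ) ^ n • KreinExt.weakDeriv (2 * n) (f : KreinExt.L2 a b)) ∧
    KreinExt.IsBoundaryTriplet (KreinExt.minimalOp n a b)
      (fun f => KreinExt.Gamma0 n (f : KreinExt.L2 a b))
      (fun f => KreinExt.Gamma1 n (f : KreinExt.L2 a b)) ∧
    (∃! K : KreinExt.L2 a b →ₗ.[ℂ] KreinExt.L2 a b,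
      KreinExt.IsKreinExtension (KreinExt.minimalOp n a b) K) ∧
    IsUnit (KreinExt.matT2 n (b - a)).det ∧
    ∀ K : KreinExt.L2 a b →ₗ.[ℂ] KreinExt.L2 a b,
      KreinExt.IsKreinExtension (KreinExt.minimalOp n a b) K →
      (K.domain : Set (KreinExt.L2 a b))
          = {f | f ∈ KreinExt.sobolev a b (2 * n) ∧
              KreinExt.descJet (2 * n) f b
                = (KreinExt.matT (2 * n) (b - a)).mulVec (KreinExt.descJet (2 * n) f a)} ∧
      (K.domain : Set (KreinExt.L2 a b))
          = {f | f ∈ KreinExt.sobolev a b (2 * n) ∧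
              (KreinExt.Gamma1 n f).ofLp
                = (KreinExt.matBK n (b - a)).mulVec (KreinExt.Gamma0 n f).ofLp} ∧
      ∀ f : K.domain,
        K f = (-1 : ℂ) ^ n • KreinExt.weakDeriv (2 * n) (f : KreinExt.L2 a b) := by
  have hK := KreinExt.isKreinExtension_minimalOp (n := n) hab
  refine ⟨KreinExt.domain_adjoint_minimalOp n hab, KreinExt.adjoint_minimalOp_apply hab.le,
    KreinExt.isBoundaryTriplet_Gamma hab, ⟨_, hK, fun K' hK' => hK'.unique hK⟩,
    KreinExt.isUnit_det_matT2 n hab, fun K hK' => ?_⟩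
  obtain rfl := hK'.unique hK
  have hsob : ∀ f : KreinExt.L2 a b, f ∈ KreinExt.softDomain (KreinExt.minimalOp n a b) →
      f ∈ KreinExt.sobolev a b (2 * n) := fun f hf => by
    rw [← KreinExt.domain_adjoint_minimalOp n hab]
    exact hf.1
  refine ⟨?_, ?_, fun f => KreinExt.adjoint_minimalOp_apply hab.le ⟨f, f.2.1⟩⟩
  · ext f
    constructor
    · intro hf
      obtain ⟨F, hF⟩ := (KreinExt.mem_sobolev_iff hab).1 (hsob f hf)
      exact ⟨hsob f hf, (KreinExt.descJet_eq_iff hab hF).2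
        ((KreinExt.mem_softDomain_minimalOp_iff hab hF).1 hf)⟩
    · rintro ⟨hf, h⟩
      obtain ⟨F, hF⟩ := (KreinExt.mem_sobolev_iff hab).1 hf
      exact (KreinExt.mem_softDomain_minimalOp_iff hab hF).2
        ((KreinExt.descJet_eq_iff hab hF).1 h)
  · ext f
    constructor
    · intro hf
      obtain ⟨F, hF⟩ := (KreinExt.mem_sobolev_iff hab).1 (hsob f hf)
      exact ⟨hsob f hf, (KreinExt.Gamma1_eq_iff hab hF).2
        ((KreinExt.mem_softDomain_minimalOp_iff hab hF).1 hf)⟩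
    · rintro ⟨hf, h⟩
      obtain ⟨F, hF⟩ := (KreinExt.mem_sobolev_iff hab).1 hf
      exact (KreinExt.mem_softDomain_minimalOp_iff hab hF).2
        ((KreinExt.Gamma1_eq_iff hab hF).1 h)
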